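/- **Theorem (Baues–Pirashvili).** Write $\mathrm{Gr}$ and $\mathrm{Ab}$ for the categories of groups and of abelian groups, $\langle\mathbb Z\rangle$ for the full subcategory of $\mathrm{Gr}$ whose objects are the free groups of finite rank $n\ge 0$, $\vee$ for the free product, and $i_1,i_2\colon G\to G\vee G$ for the two injections. Let $\mathcal C$ be $\langle\mathbb Z\rangle$ or $\mathrm{Gr}$. For a functor $F\colon\mathcal C\to\mathrm{Ab}$ put $$F(X\mid Y)=\ker\big(F(X\vee Y)\to F(X)\times F(Y)\big),$$ the map being induced by the two canonical retractions, and let $F(X\mid Y\mid Z)$ be the second cross-effect of the functor $F(-\mid Z)$ at $(X,Y)$. Call $F$ *reduced* if $F(0)=0$, and *quadratic* if $F(X\mid Y\mid Z)=0$ for all $X,Y,Z$. A *square group* is a diagram $M=(M_e\xrightarrow{H}M_{ee}\xrightarrow{P}M_e)$ in which $M_e$ is a group and $M_{ee}$ an abelian group (both written additively), $P$ is a homomorphism, and $H$ is a map whose cross effect $(a\mid b)_H=H(a+b)-H(a)-H(b)$ is linear in $a$ and in $b$, such that for all $x,y\in M_e$ and $a,b\in M_{ee}$ $$(Pa\mid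 y)_H=0=(x\mid Pb)_H,\qquad P(x\mid y)_H=-x-y+x+y,\qquad PHP(a)=2P(a).$$ A morphism $M\to N$ is a pair of homomorphisms $M_e\to N_e$, $M_{ee}\to N_{ee}$ commuting with $H$ and with $P$. The square group is said to have $H$ *linear* if $H$ is a homomorphism. For a reduced quadratic functor $F$ let $H\colon F(\mathbb Z)\to F(\mathbb Z\mid\mathbb Z)$ be given by $H(a)=F(\mu)a-F(i_1)a-F(i_2)a$, where $\mu\colon\mathbb Z\to\mathbb Z\vee\mathbb Z$ sends the generator $x$ to $i_1(x)i_2(x)$, and let $P\colon F(\mathbb Z\mid\mathbb Z)\to F(\mathbb Z)$ be the restriction of $F(\nabla)$, where $\nabla\colon\mathbb Z\vee\mathbb Z\to\mathbb Z$ is the folding map. Then: 1. The functor $$F\longmapsto\big(F(\mathbb Z)\xrightarrow{H}F(\mathbb Z\mid\mathbb Z)\xrightarrow{P}F(\mathbb Z)\big)$$ is an equivalence from the category of reduced quadratic functors $\langle\mathbb Z\rangle\to\mathrm{Ab}$ (and natural transformations) to the category of square groups with $H$ linear. 2. The same assignment is an equivalence from the category of those reduced quadratic functors $\mathrm{Gr}\to\mathrm{Ab}$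 that preserve filtered colimits and reflexive coequalizers to the category of square groups with $H$ linear. -/

import Mathlib

open CategoryTheory CategoryTheory.Limits

universe u v w

/-! ### Cross-effects and quadratic functors -/

section CrossEffects

theorem functor_map_comp_apply {C : Type v} [Category.{w} C] (F : C ⥤ AddCommGrpCat.{u}) {X Y Z : C} (f : X ⟶ Y) (g : Y ⟶ Z)
    (x : F.obj X) : F.map g (F.map f x) = F.map (f ≫ g) x := by
  simp

variable {C : Type v} [Category.{w} C] [HasZeroMorphisms C] [HasBinaryCoproducts C]

/-- The retraction `r₁ : X ∨ Y ⟶ X`, equal to the identity on `X` and to the null map on `Y`. -/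
noncomputable def retr₁ (X Y : C) : X ⨿ Y ⟶ X := coprod.desc (𝟙 X) 0

/-- The retraction `r₂ : X ∨ Y ⟶ Y`, equal to the null map on `X` and to the identity on `Y`. -/
noncomputable def retr₂ (X Y : C) : X ⨿ Y ⟶ Y := coprod.desc 0 (𝟙 Y)

theorem map_retr₁ {X Y X' Y' : C} (f : X ⟶ X') (g : Y ⟶ Y') :
    coprod.map f g ≫ retr₁ X' Y' = retr₁ X Y ≫ f := by
  ext <;> simp [retr₁]

theorem map_retr₂ {X Y X' Y' : C} (f : X ⟶ X') (g : Y ⟶ Y') :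
    coprod.map f g ≫ retr₂ X' Y' = retr₂ X Y ≫ g := by
  ext <;> simp [retr₂]

/-- The second cross-effect `F(X | Y)`: the kernel of
`(F(r₁), F(r₂)) : F(X ∨ Y) → F(X) × F(Y)`. -/
noncomputable def crossEffect (F : C ⥤ AddCommGrpCat.{u}) (X Y : C) : AddSubgroup (F.obj (X ⨿ Y)) :=
  (F.map (retr₁ X Y)).hom.ker ⊓ (F.map (retr₂ X Y)).hom.ker

theorem mem_crossEffect (F : C ⥤ AddCommGrpCat.{u}) {X Y : C} (x : F.obj (X ⨿ Y)) :
    x ∈ crossEffect F X Y ↔ F.map (retr₁ X Y) x = 0 ∧ F.map (retr₂ X Y) x = 0 := Iff.rfl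

theorem map_mem_crossEffect (F : C ⥤ AddCommGrpCat.{u}) {X Y X' Y' : C} (f : X ⟶ X')
    (g : Y ⟶ Y') {x : F.obj (X ⨿ Y)} (hx : x ∈ crossEffect F X Y) :
    F.map (coprod.map f g) x ∈ crossEffect F X' Y' := by
  rw [mem_crossEffect] at hx ⊢
  constructor
  · rw [functor_map_comp_apply, map_retr₁, ← functor_map_comp_apply, hx.1, map_zero]
  · rw [functor_map_comp_apply, map_retr₂, ← functor_map_comp_apply, hx.2, map_zero]

/-- The map `F(f | g) : F(X | Y) → F(X' | Y')` induced by `F(f ∨ g)`. -/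
noncomputable def crossEffectMap (F : C ⥤ AddCommGrpCat.{u}) {X Y X' Y' : C} (f : X ⟶ X')
    (g : Y ⟶ Y') : crossEffect F X Y →+ crossEffect F X' Y' where
  toFun x := ⟨F.map (coprod.map f g) x.1, map_mem_crossEffect F f g x.2⟩
  map_zero' := Subtype.ext (map_zero (F.map (coprod.map f g)).hom)
  map_add' x y := Subtype.ext (map_add (F.map (coprod.map f g)).hom x.1 y.1)

/-- The second cross-effect as a functor of its first variable, `F(- | Y) : C ⥤ Ab`. -/
noncomputable def crossEffectLeft (F : C ⥤ AddCommGrpCat.{u}) (Y : C) :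
    C ⥤ AddCommGrpCat.{u} where
  obj X := AddCommGrpCat.of (crossEffect F X Y)
  map f := AddCommGrpCat.ofHom (crossEffectMap F f (𝟙 Y))
  map_id X := by
    ext x
    change F.map (coprod.map (𝟙 X) (𝟙 Y)) x.1 = x.1
    simp
  map_comp f g := by
    ext x
    change F.map (coprod.map (f ≫ g) (𝟙 Y)) x.1 =
      F.map (coprod.map g (𝟙 Y)) (F.map (coprod.map f (𝟙 Y)) x.1)
    rw [functor_map_comp_apply]
    simp

/-- The third cross-effect `F(X | Y | Z)`: the second cross-effect of `F(- | Z)` at `(X, Y)`. -/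
noncomputable def crossEffect₃ (F : C ⥤ AddCommGrpCat.{u}) (X Y Z : C) :
    AddSubgroup ((crossEffectLeft F Z).obj (X ⨿ Y)) :=
  crossEffect (crossEffectLeft F Z) X Y

/-- `F` is quadratic (polynomial of degree at most two): its third cross-effect vanishes. -/
def IsQuadraticFunctor (F : C ⥤ AddCommGrpCat.{u}) : Prop :=
  ∀ X Y Z : C, crossEffect₃ F X Y Z = ⊥

open ZeroObject in
/-- `F` is reduced: `F(0) = 0`. -/
def IsReducedFunctor [HasZeroObject C] (F : C ⥤ AddCommGrpCat.{u}) : Prop :=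
  IsZero (F.obj (0 : C))

/-- The objects of the category of reduced quadratic functors from `C` to `Ab`; morphisms
are the natural transformations. -/
def reducedQuadratic (C : Type v) [Category.{w} C] [HasZeroMorphisms C] [HasBinaryCoproducts C]
    [HasZeroObject C] : ObjectProperty (C ⥤ AddCommGrpCat.{u}) :=
  fun F => IsReducedFunctor F ∧ IsQuadraticFunctor F

end CrossEffects

/-! ### Square groups -/

/-- The cross effect `(a | b)_H = H(a + b) - H(a) - H(b)` of a map `H`. -/
def mapCross {G : Type u} {A : Type v} [AddGroup G] [AddCommGroup A] (H : G → A) (a b : G) : A :=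
  H (a + b) - H a - H b

/-- A square group `M = (M_e → M_ee → M_e)`: here `M_e` is a group (written additively, not
assumed commutative), `M_ee` is an abelian group, `H` is a quadratic map and `P` is a
homomorphism. -/
structure SquareGroup where
  e : Type u
  ee : Type u
  [group_e : AddGroup e]
  [group_ee : AddCommGroup ee]
  H : e → ee
  P : ee →+ e
  cross_add_left : ∀ a a' b : e, mapCross H (a + a') b = mapCross H a b + mapCross H a' b
  cross_add_right : ∀ a b b' : e, mapCross H a (b + b') = mapCross H a b + mapCross H a b'
  cross_P_left : ∀ (a : ee) (y : e), mapCross H (P a) y = 0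
  cross_P_right : ∀ (x : e) (b : ee), mapCross H x (P b) = 0
  P_cross : ∀ x y : e, P (mapCross H x y) = -x - y + x + y
  P_H_P : ∀ a : ee, P (H (P a)) = 2 • P a

attribute [instance] SquareGroup.group_e SquareGroup.group_ee

namespace SquareGroup

/-- Morphisms of square groups: pairs of homomorphisms compatible with `H` and `P`. -/
@[ext]
structure Hom (M N : SquareGroup.{u}) where
  e : M.e →+ N.e
  ee : M.ee →+ N.ee
  comm_H : ∀ a : M.e, ee (M.H a) = N.H (e a)
  comm_P : ∀ a : M.ee, e (M.P a) = N.P (ee a)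

instance : Category SquareGroup.{u} where
  Hom := Hom
  id M := ⟨AddMonoidHom.id _, AddMonoidHom.id _, fun _ => rfl, fun _ => rfl⟩
  comp f g := ⟨g.e.comp f.e, g.ee.comp f.ee,
    fun a => by simp [f.comm_H, g.comm_H], fun a => by simp [f.comm_P, g.comm_P]⟩

/-- The square groups for which `H` is linear, that is, a homomorphism; they are regarded as
a full subcategory of the category of square groups. -/
def linear : ObjectProperty SquareGroup.{u} :=
  fun M => ∀ a b : M.e, M.H (a + b) = M.H a + M.H b

end SquareGroup

/-! ### The square group of a reduced quadratic functor -/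

section SquareOfFunctor

variable {C : Type v} [Category.{w} C] [HasZeroMorphisms C] [HasBinaryCoproducts C]
  [HasZeroObject C]

open ZeroObject in
theorem map_zero_apply {F : C ⥤ AddCommGrpCat.{u}} (hF : IsReducedFunctor F) {X Y : C} (x : F.obj X) :
    F.map (0 : X ⟶ Y) x = 0 := by
  have h : (0 : X ⟶ Y) = (0 : X ⟶ (0 : C)) ≫ (0 : (0 : C) ⟶ Y) := by simp
  rw [h, ← functor_map_comp_apply]
  have := AddCommGrpCat.subsingleton_of_isZero hF
  rw [Subsingleton.elim (F.map (0 : X ⟶ (0 : C)) x) 0, map_zero]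

open ZeroObject in
theorem isReduced_crossEffectLeft (F : C ⥤ AddCommGrpCat.{u}) (Y : C) :
    IsReducedFunctor (crossEffectLeft F Y) := by
  have key : retr₂ (0 : C) Y ≫ coprod.inr = 𝟙 ((0 : C) ⨿ Y) := by
    apply coprod.hom_ext
    · exact (isZero_zero C).eq_of_src _ _
    · simp [retr₂, coprod.inr_desc]
  refine @AddCommGrpCat.isZero_of_subsingleton _ ⟨fun x y => ?_⟩
  have h : ∀ z : crossEffect F (0 : C) Y, z = 0 := fun z => by
    have hz : F.map coprod.inr (F.map (retr₂ (0 : C) Y) z.1) = z.1 := by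
      rw [functor_map_comp_apply, key]
      simp
    apply Subtype.ext
    rw [← hz, ((mem_crossEffect F z.1).1 z.2).2, map_zero]
    rfl
  exact (h x).trans (h y).symm

/-- A comultiplication `μ : E ⟶ E ∨ E` on an object `E` for which the null map is a two-sided
counit. -/
structure Comult (E : C) where
  μ : E ⟶ E ⨿ E
  μ_retr₁ : μ ≫ retr₁ E E = 𝟙 E
  μ_retr₂ : μ ≫ retr₂ E E = 𝟙 E

/-- `H : F(E) → F(E | E)`, `x ↦ F(μ) x - F(i₁) x - F(i₂) x`. -/
noncomputable def hopfMap {F : C ⥤ AddCommGrpCat.{u}} (hF : IsReducedFunctor F) {E : C}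
    (c : Comult E) : F.obj E →+ crossEffect F E E :=
  AddMonoidHom.codRestrict
    ((F.map c.μ).hom - (F.map (coprod.inl : E ⟶ E ⨿ E)).hom -
      (F.map (coprod.inr : E ⟶ E ⨿ E)).hom) _ (fun x => by
    rw [mem_crossEffect]
    constructor
    · change F.map (retr₁ E E) (F.map c.μ x - F.map coprod.inl x - F.map coprod.inr x) = 0
      rw [map_sub, map_sub, functor_map_comp_apply, functor_map_comp_apply,
        functor_map_comp_apply, c.μ_retr₁]
      have h : (coprod.inr : E ⟶ E ⨿ E) ≫ retr₁ E E = 0 := by simp [retr₁, coprod.inr_desc]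
      have h' : (coprod.inl : E ⟶ E ⨿ E) ≫ retr₁ E E = 𝟙 E := by simp [retr₁, coprod.inl_desc]
      rw [h, h', map_zero_apply hF, sub_self, sub_zero]
    · change F.map (retr₂ E E) (F.map c.μ x - F.map coprod.inl x - F.map coprod.inr x) = 0
      rw [map_sub, map_sub, functor_map_comp_apply, functor_map_comp_apply,
        functor_map_comp_apply, c.μ_retr₂]
      have h : (coprod.inl : E ⟶ E ⨿ E) ≫ retr₂ E E = 0 := by simp [retr₂, coprod.inl_desc]
      have h' : (coprod.inr : E ⟶ E ⨿ E) ≫ retr₂ E E = 𝟙 E := by simp [retr₂, coprod.inr_desc]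
      rw [h, h', map_zero_apply hF, sub_zero, sub_self])

theorem hopfMap_coe {F : C ⥤ AddCommGrpCat.{u}} (hF : IsReducedFunctor F) {E : C}
    (c : Comult E) (x : F.obj E) :
    (hopfMap hF c x : F.obj (E ⨿ E)) =
      F.map c.μ x - F.map coprod.inl x - F.map coprod.inr x := rfl

/-- `P : F(E | E) → F(E)`, the restriction of `F(∇)`, where `∇ : E ∨ E ⟶ E` is the folding map. -/
noncomputable def foldMap (F : C ⥤ AddCommGrpCat.{u}) (E : C) : crossEffect F E E →+ F.obj E :=
  (F.map (coprod.desc (𝟙 E) (𝟙 E))).hom.comp (crossEffect F E E).subtype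

/-- The endomorphism `[2] = ∇ ∘ μ` of `E`. -/
noncomputable def Comult.double {E : C} (c : Comult E) : E ⟶ E :=
  c.μ ≫ coprod.desc (𝟙 E) (𝟙 E)

theorem map_double_of_linear {F : C ⥤ AddCommGrpCat.{u}} (hF : IsReducedFunctor F) {E : C}
    (c : Comult E) (h : crossEffect F E E = ⊥) (x : F.obj E) :
    F.map c.double x = x + x := by
  have h₁ : (hopfMap hF c x : F.obj (E ⨿ E)) = 0 :=
    (AddSubgroup.mem_bot).1 (h.le (hopfMap hF c x).2)
  rw [hopfMap_coe, sub_sub, sub_eq_zero] at h₁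
  rw [Comult.double, ← functor_map_comp_apply, h₁, map_add, functor_map_comp_apply,
    functor_map_comp_apply, coprod.inl_desc, coprod.inr_desc]
  simp

theorem map_double_left {F : C ⥤ AddCommGrpCat.{u}}
    (hQ : IsQuadraticFunctor F) {E : C} (c : Comult E) {Y : C} {x : F.obj (E ⨿ Y)}
    (hx : x ∈ crossEffect F E Y) : F.map (coprod.map c.double (𝟙 Y)) x = x + x :=
  congrArg Subtype.val
    (map_double_of_linear (isReduced_crossEffectLeft F Y) c (hQ E E Y) ⟨x, hx⟩)

theorem map_swap_mem {F : C ⥤ AddCommGrpCat.{u}} {X Y : C} {x : F.obj (X ⨿ Y)}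
    (hx : x ∈ crossEffect F X Y) :
    F.map (coprod.desc coprod.inr coprod.inl : X ⨿ Y ⟶ Y ⨿ X) x ∈ crossEffect F Y X := by
  rw [mem_crossEffect] at hx ⊢
  have h₁ : (coprod.desc coprod.inr coprod.inl : X ⨿ Y ⟶ Y ⨿ X) ≫ retr₁ Y X = retr₂ X Y := by
    ext <;> simp [retr₁, retr₂, coprod.inl_desc, coprod.inr_desc]
  have h₂ : (coprod.desc coprod.inr coprod.inl : X ⨿ Y ⟶ Y ⨿ X) ≫ retr₂ Y X = retr₁ X Y := by
    ext <;> simp [retr₁, retr₂, coprod.inl_desc, coprod.inr_desc]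
  rw [functor_map_comp_apply, functor_map_comp_apply, h₁, h₂]
  exact ⟨hx.2, hx.1⟩

theorem map_double_right {F : C ⥤ AddCommGrpCat.{u}}
    (hQ : IsQuadraticFunctor F) {E : C} (c : Comult E) {X : C} {x : F.obj (X ⨿ E)}
    (hx : x ∈ crossEffect F X E) : F.map (coprod.map (𝟙 X) c.double) x = x + x := by
  have h := map_double_left hQ c (map_swap_mem hx)
  have h' := congrArg (F.map (coprod.desc coprod.inr coprod.inl : E ⨿ X ⟶ X ⨿ E)) h
  rw [map_add, functor_map_comp_apply, functor_map_comp_apply, functor_map_comp_apply] at h'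
  have e₁ : (coprod.desc coprod.inr coprod.inl : X ⨿ E ⟶ E ⨿ X) ≫
      coprod.desc coprod.inr coprod.inl = 𝟙 _ := by
    ext <;> simp [coprod.inl_desc, coprod.inr_desc]
  have e₂ : (coprod.desc coprod.inr coprod.inl : X ⨿ E ⟶ E ⨿ X) ≫
      coprod.map c.double (𝟙 X) ≫ coprod.desc coprod.inr coprod.inl =
        coprod.map (𝟙 X) c.double := by
    ext <;> simp [coprod.inl_desc, coprod.inr_desc]
  rw [e₁, e₂] at h'
  simpa using h'

theorem foldMap_hopfMap_foldMap {F : C ⥤ AddCommGrpCat.{u}} (hF : IsReducedFunctor F)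
    (hQ : IsQuadraticFunctor F) {E : C} (c : Comult E) (x : crossEffect F E E) :
    foldMap F E (hopfMap hF c (foldMap F E x)) = 2 • foldMap F E x := by
  set D : E ⨿ E ⟶ E := coprod.desc (𝟙 E) (𝟙 E) with hD
  change F.map D (F.map c.μ (F.map D x.1) - F.map coprod.inl (F.map D x.1) -
    F.map coprod.inr (F.map D x.1)) = 2 • F.map D x.1
  have e₁ : D ≫ c.double =
      (coprod.map c.double (𝟙 E) ≫ coprod.map (𝟙 E) c.double) ≫ D := by
    ext <;> simp [hD]
  have e₂ : (coprod.inl : E ⟶ E ⨿ E) ≫ D = 𝟙 E := by simp [hD, coprod.inl_desc]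
  have e₃ : (coprod.inr : E ⟶ E ⨿ E) ≫ D = 𝟙 E := by simp [hD, coprod.inr_desc]
  have h₁ : F.map D (F.map c.μ (F.map D x.1)) = F.map c.double (F.map D x.1) := by
    rw [functor_map_comp_apply F c.μ D, Comult.double]
  have h₂ : F.map c.double (F.map D x.1) = F.map D (x.1 + x.1 + (x.1 + x.1)) := by
    rw [functor_map_comp_apply, e₁, ← functor_map_comp_apply, ← functor_map_comp_apply,
      map_double_left hQ c x.2, map_add, map_double_right hQ c x.2]
  rw [map_sub, map_sub, h₁, h₂, functor_map_comp_apply F coprod.inl D,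
    functor_map_comp_apply F coprod.inr D, e₂, e₃]
  simp only [map_add, CategoryTheory.Functor.map_id, AddCommGrpCat.hom_id, AddMonoidHom.id_apply]
  abel

/-- The square group `F(E) → F(E | E) → F(E)` of a reduced quadratic functor `F`. -/
noncomputable def squareObj {F : C ⥤ AddCommGrpCat.{u}} (hF : reducedQuadratic C F) {E : C}
    (c : Comult E) : SquareGroup.{u} where
  e := F.obj E
  ee := crossEffect F E E
  H := hopfMap hF.1 c
  P := foldMap F E
  cross_add_left a a' b := by simp [mapCross]
  cross_add_right a b b' := by simp [mapCross]
  cross_P_left a y := by simp [mapCross]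
  cross_P_right x b := by simp [mapCross]
  P_cross x y := by
    have h : mapCross (hopfMap hF.1 c) x y = 0 := by simp [mapCross]
    rw [h, map_zero]
    abel
  P_H_P a := foldMap_hopfMap_foldMap hF.1 hF.2 c a

/-- The morphism of square groups induced by a natural transformation `η`: it consists of
`η_E : F(E) → G(E)` and of the restriction `F(E | E) → G(E | E)` of `η_{E ∨ E}`. -/
noncomputable def squareHom {F G : C ⥤ AddCommGrpCat.{u}} (hF : reducedQuadratic C F)
    (hG : reducedQuadratic C G) {E : C} (c : Comult E) (η : F ⟶ G) :
    squareObj hF c ⟶ squareObj hG c where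
  e := (η.app E).hom
  ee :=
    { toFun := fun x => ⟨η.app (E ⨿ E) x.1, by
        have hx := (mem_crossEffect F x.1).1 x.2
        rw [mem_crossEffect, ← NatTrans.naturality_apply, ← NatTrans.naturality_apply, hx.1, hx.2]
        exact ⟨map_zero (η.app E).hom, map_zero (η.app E).hom⟩⟩
      map_zero' := Subtype.ext (map_zero (η.app (E ⨿ E)).hom)
      map_add' := fun x y => Subtype.ext (map_add (η.app (E ⨿ E)).hom x.1 y.1) }
  comm_H a := Subtype.ext (by
    change η.app (E ⨿ E) (F.map c.μ a - F.map coprod.inl a - F.map coprod.inr a) =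
      G.map c.μ (η.app E a) - G.map coprod.inl (η.app E a) - G.map coprod.inr (η.app E a)
    have h {X Y : C} (f : X ⟶ Y) (y : F.obj X) : η.app Y (F.map f y) = G.map f (η.app X y) :=
      NatTrans.naturality_apply η f y
    rw [map_sub, map_sub]
    exact congrArg₂ _ (congrArg₂ _ (h _ _) (h _ _)) (h _ _))
  comm_P a := NatTrans.naturality_apply η (coprod.desc (𝟙 E) (𝟙 E)) a.1

/-- The functor from reduced quadratic functors to square groups with linear `H`,
`F ↦ (F(E) → F(E | E) → F(E))`. -/
noncomputable def squareFunctor {E : C} (c : Comult E) :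
    (reducedQuadratic.{u} C).FullSubcategory ⥤ SquareGroup.linear.{u}.FullSubcategory :=
  SquareGroup.linear.lift
    { obj := fun F => squareObj F.property c
      map := fun {F G} η => squareHom F.property G.property c η.hom
      map_id := fun _ => rfl
      map_comp := fun _ _ => rfl }
    (fun F => map_add (hopfMap F.property.1 c))

end SquareOfFunctor

/-! ### Free groups of finite rank -/

/-- The category of free groups of finite rank: the objects are the free groups on `n`
generators, `n ≥ 0`, and the morphisms are all group homomorphisms. -/
structure FreeGrp where
  rank : ℕ

namespace FreeGrp

/-- A morphism of free groups of finite rank is a group homomorphism. -/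
@[ext]
structure Hom (X Y : FreeGrp) where
  hom : FreeGroup (Fin X.rank) →* FreeGroup (Fin Y.rank)

instance : Category FreeGrp where
  Hom := Hom
  id _ := ⟨MonoidHom.id _⟩
  comp f g := ⟨g.hom.comp f.hom⟩

theorem hom_ext {X Y : FreeGrp} {f g : X ⟶ Y}
    (h : ∀ i, f.hom (FreeGroup.of i) = g.hom (FreeGroup.of i)) : f = g :=
  Hom.ext (FreeGroup.ext_hom _ _ h)

theorem comp_hom_apply {X Y Z : FreeGrp} (f : X ⟶ Y) (g : Y ⟶ Z) (x : FreeGroup (Fin X.rank)) :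
    (f ≫ g).hom x = g.hom (f.hom x) := rfl

instance : HasZeroMorphisms FreeGrp where
  zero _ _ := ⟨⟨1⟩⟩
  comp_zero _ _ := rfl
  zero_comp _ _ _ f := Hom.ext (MonoidHom.ext fun _ => map_one f.hom)

theorem zero_hom_apply {X Y : FreeGrp} (x : FreeGroup (Fin X.rank)) :
    (0 : X ⟶ Y).hom x = 1 := rfl

instance : HasZeroObject FreeGrp :=
  ⟨⟨0⟩, (IsZero.iff_id_eq_zero _).2 (hom_ext fun i => i.elim0)⟩

/-- The sum of the free groups on `m` and on `n` generators is the free group on `m + n`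
generators. -/
def sumCofan (X Y : FreeGrp) : BinaryCofan X Y :=
  BinaryCofan.mk (P := ⟨X.rank + Y.rank⟩) ⟨FreeGroup.map (Fin.castAdd Y.rank)⟩
    ⟨FreeGroup.map (Fin.natAdd X.rank)⟩

/-- The morphism out of the sum with given restrictions to the summands. -/
def sumDesc {X Y T : FreeGrp} (f : X ⟶ T) (g : Y ⟶ T) : (⟨X.rank + Y.rank⟩ : FreeGrp) ⟶ T :=
  ⟨FreeGroup.lift (Fin.addCases (fun i => f.hom (FreeGroup.of i))
    (fun i => g.hom (FreeGroup.of i)))⟩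

/-- The universal property of the sum. -/
def sumCofanIsColimit (X Y : FreeGrp) : IsColimit (sumCofan X Y) :=
  BinaryCofan.isColimitMk (fun s => sumDesc s.inl s.inr)
    (fun s => hom_ext fun i => by
      rw [comp_hom_apply]
      simp [sumDesc])
    (fun s => hom_ext fun i => by
      rw [comp_hom_apply]
      simp [sumDesc])
    (fun s m hf hg => by
      refine hom_ext fun i => ?_
      have hf' := fun j => congrArg (fun k => k.hom (FreeGroup.of j)) hf
      have hg' := fun j => congrArg (fun k => k.hom (FreeGroup.of j)) hg
      simp only [comp_hom_apply, FreeGroup.map.of] at hf' hg'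
      dsimp only at i
      induction i using Fin.addCases with
      | left i => simp [sumDesc, hf']
      | right i => simp [sumDesc, hg'])

instance : HasBinaryCoproducts FreeGrp :=
  have : ∀ {X Y : FreeGrp}, HasColimit (pair X Y) :=
    fun {X Y} => ⟨⟨sumCofan X Y, sumCofanIsColimit X Y⟩⟩
  hasBinaryCoproducts_of_hasColimit_pair _

/-- The infinite cyclic group `ℤ`, as the free group on one generator. -/
abbrev int : FreeGrp := ⟨1⟩

/-- The cogroup structure `μ : ℤ ⟶ ℤ ∨ ℤ` of the infinite cyclic group, which sends the
generator `x` to the product `i₁(x) i₂(x)`. -/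
noncomputable def intComult : Comult int where
  μ := ⟨FreeGroup.lift fun i =>
    (coprod.inl : int ⟶ int ⨿ int).hom (FreeGroup.of i) *
      (coprod.inr : int ⟶ int ⨿ int).hom (FreeGroup.of i)⟩
  μ_retr₁ := hom_ext fun i => by
    rw [comp_hom_apply]
    dsimp only
    rw [FreeGroup.lift_apply_of, map_mul, ← comp_hom_apply, ← comp_hom_apply, retr₁,
      coprod.inl_desc, coprod.inr_desc, zero_hom_apply, mul_one]
  μ_retr₂ := hom_ext fun i => by
    rw [comp_hom_apply]
    dsimp only
    rw [FreeGroup.lift_apply_of, map_mul, ← comp_hom_apply, ← comp_hom_apply, retr₂,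
      coprod.inl_desc, coprod.inr_desc, zero_hom_apply, one_mul]

end FreeGrp

/-! ### All groups -/

namespace GrpCat

instance : HasZeroMorphisms GrpCat.{u} where
  zero X Y := ⟨GrpCat.ofHom (1 : X →* Y)⟩
  comp_zero _ _ := rfl
  zero_comp _ _ _ f := GrpCat.hom_ext (MonoidHom.ext fun _ => map_one f.hom)

theorem zero_hom_apply {X Y : GrpCat.{u}} (x : X) : (0 : X ⟶ Y).hom x = 1 := rfl

/-- The sum of two groups is their free product. -/
def freeProductCofan (X Y : GrpCat.{u}) : BinaryCofan X Y :=
  BinaryCofan.mk (P := GrpCat.of (Monoid.Coprod X Y)) (GrpCat.ofHom Monoid.Coprod.inl)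
    (GrpCat.ofHom Monoid.Coprod.inr)

/-- The universal property of the free product. -/
def freeProductCofanIsColimit (X Y : GrpCat.{u}) : IsColimit (freeProductCofan X Y) :=
  BinaryCofan.IsColimit.mk _
    (fun f g => GrpCat.ofHom (Monoid.Coprod.lift f.hom g.hom))
    (fun _ _ => GrpCat.hom_ext (Monoid.Coprod.lift_comp_inl _ _))
    (fun _ _ => GrpCat.hom_ext (Monoid.Coprod.lift_comp_inr _ _))
    (fun {T} f g m hf hg => by
      subst hf hg
      exact GrpCat.hom_ext (Monoid.Coprod.hom_ext rfl rfl))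

instance : HasBinaryCoproducts GrpCat.{u} :=
  have : ∀ {X Y : GrpCat.{u}}, HasColimit (pair X Y) :=
    fun {X Y} => ⟨⟨freeProductCofan X Y, freeProductCofanIsColimit X Y⟩⟩
  hasBinaryCoproducts_of_hasColimit_pair _

/-- The infinite cyclic group `ℤ`, as the free group on one generator. -/
abbrev int : GrpCat.{u} := GrpCat.of (FreeGroup PUnit.{u + 1})

/-- The cogroup structure `μ : ℤ ⟶ ℤ ∨ ℤ` of the infinite cyclic group, which sends the
generator `x` to the product `i₁(x) i₂(x)`. -/
noncomputable def intComult : Comult int.{u} where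
  μ := GrpCat.ofHom (FreeGroup.lift fun i : PUnit =>
    (coprod.inl : int ⟶ int ⨿ int).hom (FreeGroup.of i) *
      (coprod.inr : int ⟶ int ⨿ int).hom (FreeGroup.of i))
  μ_retr₁ := GrpCat.hom_ext (FreeGroup.ext_hom _ _ fun i => by
    rw [GrpCat.hom_comp, MonoidHom.comp_apply, GrpCat.hom_ofHom, FreeGroup.lift_apply_of, map_mul,
      ← GrpCat.comp_apply, ← GrpCat.comp_apply, retr₁, coprod.inl_desc, coprod.inr_desc]
    exact mul_one _)
  μ_retr₂ := GrpCat.hom_ext (FreeGroup.ext_hom _ _ fun i => by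
    rw [GrpCat.hom_comp, MonoidHom.comp_apply, GrpCat.hom_ofHom, FreeGroup.lift_apply_of, map_mul,
      ← GrpCat.comp_apply, ← GrpCat.comp_apply, retr₂, coprod.inl_desc, coprod.inr_desc]
    exact one_mul _)

/-- The objects of the category of reduced quadratic functors from groups to abelian groups
which preserve filtered colimits and reflexive coequalizers. -/
def goodQuadratic : ObjectProperty (GrpCat.{u} ⥤ AddCommGrpCat.{u}) :=
  fun F => reducedQuadratic GrpCat.{u} F ∧ PreservesFilteredColimitsOfSize.{u, u} F ∧
    ∀ ⦃X Y : GrpCat.{u}⦄ (f g : X ⟶ Y), IsReflexivePair f g → PreservesColimit (parallelPair f g) F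

/-- The functor `F ↦ (F(ℤ) → F(ℤ | ℤ) → F(ℤ))` on functors preserving filtered colimits and
reflexive coequalizers. -/
noncomputable def goodSquareFunctor :
    goodQuadratic.{u}.FullSubcategory ⥤ SquareGroup.linear.{u}.FullSubcategory :=
  ObjectProperty.ιOfLE (fun _ h => h.1 : goodQuadratic.{u} ≤ reducedQuadratic.{u} GrpCat.{u}) ⋙
    squareFunctor intComult.{u}

end GrpCat

/-! The inverse equivalence is a tensor product. Let `F` be reduced and quadratic, and identify the
elements of a group `G` with the morphisms `ℤ ⟶ G`. An element `x` acts on `a ∈ F(ℤ)` by `F(x)a`,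
and a pair `x, y` acts on `b ∈ F(ℤ | ℤ)` by `F((x, y))b`. The second symbol is bilinear in `x, y`,
since the cross-effect of a quadratic functor is additive in each variable. The first deviates from
additivity in `x` by the second at `H(a)`, and `(x, x) = x ∘ ∇` brings in `P`. `Tensor` is the
abelian group presented by exactly these relations, so there is a natural map `G ⊗ F{ℤ} → F(G)`, the
`counit`. Conversely, the symbols on the generators of the free groups of rank one and two map `M`
to the square group of `- ⊗ M`: this is `unitHom`.

The unit is bijective. Surjectivity is a computation with generators. Injectivity needs retractions
onto `M_e` and `M_ee`, that is, quadratic maps on free groups of rank one and two with prescribed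
values; these are read off from homomorphisms into a central extension (`exists_retraction_lin`,
`exists_retraction_quad`). Linearity of `H` enters there.

The counit is bijective on `F(ℤ)` and `F(ℤ | ℤ)` by the triangle identities. The decomposition `F(X
∨ ℤ) = F(X) ⊕ F(ℤ) ⊕ F(X | ℤ)` extends this to finite rank by induction
(`isIso_app_of_finitelyFree`). For all groups, `- ⊗ M` preserves filtered colimits and reflexive
coequalizers, because its relations involve finitely many elements of the group at a time
(`nonempty_isColimit_tensor`). Every group is a reflexive coequalizer of free groups, and these are
filtered colimits of free groups of finite rank.

Both categories are treated at once through `CogroupModel`. -/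

/-! ### The tensor product of a group with a square group -/

namespace SquareGroup

section Tensor

variable (M : SquareGroup.{u}) (G : Type u) [Group G]

/-- A pair of maps `G → Hom(M_e, A)` and `G × G → Hom(M_ee, A)`, of which the second is bilinear
and gives the deviation of the first from linearity. -/
structure QuadraticMap (A : Type u) [AddCommGroup A] where
  lin : G → M.e → A
  quad : G → G → M.ee → A
  lin_add : ∀ g a a', lin g (a + a') = lin g a + lin g a'
  quad_add : ∀ g h b b', quad g h (b + b') = quad g h b + quad g h b'
  lin_mul : ∀ g h a, lin (g * h) a = lin g a + lin h a + quad g h (M.H a)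
  quad_mul_left : ∀ g g' h b, quad (g * g') h b = quad g h b + quad g' h b
  quad_mul_right : ∀ g h h' b, quad g (h * h') b = quad g h b + quad g h' b
  quad_self : ∀ g b, quad g g b = lin g (M.P b)

/-- The generators of the tensor product. -/
abbrev TensorGen := G × M.e ⊕ G × G × M.ee

open FreeAbelianGroup in
/-- The relators of the tensor product. -/
inductive TensorRel : FreeAbelianGroup (M.TensorGen G) → Prop
  | lin_add (g : G) (a a' : M.e) :
      TensorRel (of (.inl (g, a + a')) - (of (.inl (g, a)) + of (.inl (g, a'))))
  | quad_add (g h : G) (b b' : M.ee) :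
      TensorRel (of (.inr (g, h, b + b')) - (of (.inr (g, h, b)) + of (.inr (g, h, b'))))
  | lin_mul (g h : G) (a : M.e) :
      TensorRel (of (.inl (g * h, a)) -
        (of (.inl (g, a)) + of (.inl (h, a)) + of (.inr (g, h, M.H a))))
  | quad_mul_left (g g' h : G) (b : M.ee) :
      TensorRel (of (.inr (g * g', h, b)) - (of (.inr (g, h, b)) + of (.inr (g', h, b))))
  | quad_mul_right (g h h' : G) (b : M.ee) :
      TensorRel (of (.inr (g, h * h', b)) - (of (.inr (g, h, b)) + of (.inr (g, h', b))))
  | quad_self (g : G) (b : M.ee) : TensorRel (of (.inr (g, g, b)) - of (.inl (g, M.P b)))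

/-- The abelian tensor product `G ⊗ M`. -/
def Tensor : Type u :=
  FreeAbelianGroup (M.TensorGen G) ⧸ AddSubgroup.closure {x | M.TensorRel G x}

instance : AddCommGroup (M.Tensor G) :=
  inferInstanceAs (AddCommGroup (_ ⧸ AddSubgroup.closure {x | M.TensorRel G x}))

/-- The projection from the free abelian group on the generators. -/
def Tensor.mk : FreeAbelianGroup (M.TensorGen G) →+ M.Tensor G :=
  QuotientAddGroup.mk' (AddSubgroup.closure {x | M.TensorRel G x})

variable {M G}

theorem Tensor.mk_eq {x y : FreeAbelianGroup (M.TensorGen G)} (h : M.TensorRel G (x - y)) :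
    Tensor.mk M G x = Tensor.mk M G y := by
  rw [← sub_eq_zero, ← map_sub]
  exact (QuotientAddGroup.eq_zero_iff _).2 (AddSubgroup.subset_closure h)

/-- The universal quadratic map. -/
def Tensor.univ : M.QuadraticMap G (M.Tensor G) where
  lin g a := Tensor.mk M G (.of (.inl (g, a)))
  quad g h b := Tensor.mk M G (.of (.inr (g, h, b)))
  lin_add g a a' := by
    rw [← map_add]; exact Tensor.mk_eq (.lin_add g a a')
  quad_add g h b b' := by
    rw [← map_add]; exact Tensor.mk_eq (.quad_add g h b b')
  lin_mul g h a := by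
    rw [← map_add, ← map_add]; exact Tensor.mk_eq (.lin_mul g h a)
  quad_mul_left g g' h b := by
    rw [← map_add]; exact Tensor.mk_eq (.quad_mul_left g g' h b)
  quad_mul_right g h h' b := by
    rw [← map_add]; exact Tensor.mk_eq (.quad_mul_right g h h' b)
  quad_self g b := Tensor.mk_eq (.quad_self g b)

namespace QuadraticMap

variable {A : Type u} [AddCommGroup A] (q : M.QuadraticMap G A)

@[simp] theorem quad_one_left (h : G) (b : M.ee) : q.quad 1 h b = 0 := by
  simpa using q.quad_mul_left 1 1 h b

@[simp] theorem quad_one_right (g : G) (b : M.ee) : q.quad g 1 b = 0 := by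
  simpa using q.quad_mul_right g 1 1 b

@[simp] theorem lin_one (a : M.e) : q.lin 1 a = 0 := by
  simpa using q.lin_mul 1 1 a

theorem quad_inv_left (g h : G) (b : M.ee) : q.quad g⁻¹ h b = -q.quad g h b := by
  have := q.quad_mul_left g⁻¹ g h b
  rw [inv_mul_cancel, quad_one_left] at this
  exact eq_neg_of_add_eq_zero_left this.symm

theorem quad_inv_right (g h : G) (b : M.ee) : q.quad g h⁻¹ b = -q.quad g h b := by
  have := q.quad_mul_right g h⁻¹ h b
  rw [inv_mul_cancel, quad_one_right] at this
  exact eq_neg_of_add_eq_zero_left this.symm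

/-- Expanding the value at `g⁻¹ * g = 1` expresses it through symbols in `g` alone, so inverses
cause no trouble when passing to a generating set. -/
theorem lin_inv (g : G) (a : M.e) : q.lin g⁻¹ a = q.quad g g (M.H a) - q.lin g a := by
  have := q.lin_mul g⁻¹ g a
  rw [inv_mul_cancel, lin_one, quad_inv_left] at this
  rw [← sub_eq_zero, this]
  abel

/-- A subgroup containing the values of a quadratic map on a generating set contains all
its values. -/
theorem mem_of_closure {S : Set G} (hS : Subgroup.closure S = ⊤) {N : AddSubgroup A}
    (hl : ∀ s ∈ S, ∀ a, q.lin s a ∈ N) (hq : ∀ s ∈ S, ∀ t ∈ S, ∀ b, q.quad s t b ∈ N) :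
    (∀ g a, q.lin g a ∈ N) ∧ ∀ g h b, q.quad g h b ∈ N := by
  have htop (g : G) : g ∈ Subgroup.closure S := hS ▸ Subgroup.mem_top g
  have h₁ (g : G) : ∀ t ∈ S, ∀ b, q.quad g t b ∈ N := by
    induction htop g using Subgroup.closure_induction with
    | mem s hs => exact hq s hs
    | one => intro t _ b; rw [quad_one_left]; exact N.zero_mem
    | mul x y _ _ hx hy =>
      intro t ht b; rw [q.quad_mul_left]; exact N.add_mem (hx t ht b) (hy t ht b)
    | inv x _ hx => intro t ht b; rw [quad_inv_left]; exact N.neg_mem (hx t ht b)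
  have h₂ (g h : G) : ∀ b, q.quad g h b ∈ N := by
    induction htop h using Subgroup.closure_induction with
    | mem s hs => exact h₁ g s hs
    | one => intro b; rw [quad_one_right]; exact N.zero_mem
    | mul x y _ _ hx hy => intro b; rw [q.quad_mul_right]; exact N.add_mem (hx b) (hy b)
    | inv x _ hx => intro b; rw [quad_inv_right]; exact N.neg_mem (hx b)
  refine ⟨fun g => ?_, h₂⟩
  induction htop g using Subgroup.closure_induction with
  | mem s hs => exact hl s hs
  | one => intro b; rw [lin_one]; exact N.zero_mem
  | mul x y _ _ hx hy =>
    intro a; rw [q.lin_mul]; exact N.add_mem (N.add_mem (hx a) (hy a)) (h₂ _ _ _)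
  | inv x _ hx => intro a; rw [lin_inv]; exact N.sub_mem (h₂ _ _ _) (hx a)

/-- The homomorphism out of the tensor product defined by a quadratic map. -/
def lift : M.Tensor G →+ A :=
  QuotientAddGroup.lift _
    (FreeAbelianGroup.lift (Sum.elim (fun x => q.lin x.1 x.2) (fun x => q.quad x.1 x.2.1 x.2.2)))
    ((AddSubgroup.closure_le _).2 fun x hx => by
      change _ = _
      cases hx <;> simp [q.lin_add, q.quad_add, q.lin_mul, q.quad_mul_left, q.quad_mul_right,
        q.quad_self])

@[simp] theorem lift_lin (g : G) (a : M.e) : q.lift (Tensor.univ.lin g a) = q.lin g a :=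
  FreeAbelianGroup.lift_apply_of _ _

@[simp] theorem lift_quad (g h : G) (b : M.ee) :
    q.lift (Tensor.univ.quad g h b) = q.quad g h b :=
  FreeAbelianGroup.lift_apply_of _ _

/-- The quadratic map obtained from a quadratic map by precomposition with a homomorphism of
groups. -/
@[simps] def comp {G' : Type u} [Group G'] (f : G' →* G) : M.QuadraticMap G' A where
  lin g a := q.lin (f g) a
  quad g h b := q.quad (f g) (f h) b
  lin_add _ := q.lin_add _
  quad_add _ _ := q.quad_add _ _
  lin_mul _ _ := by simp [q.lin_mul]
  quad_mul_left _ _ _ := by simp [q.quad_mul_left]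
  quad_mul_right _ _ _ := by simp [q.quad_mul_right]
  quad_self _ := q.quad_self _

/-- The quadratic map obtained from a quadratic map by precomposition with a morphism of
square groups. -/
@[simps] def compHom {N : SquareGroup.{u}} (f : N ⟶ M) : N.QuadraticMap G A where
  lin g a := q.lin g (f.e a)
  quad g h b := q.quad g h (f.ee b)
  lin_add _ _ _ := by rw [map_add, q.lin_add]
  quad_add _ _ _ _ := by rw [map_add, q.quad_add]
  lin_mul _ _ a := by rw [q.lin_mul, f.comm_H]
  quad_mul_left _ _ _ _ := q.quad_mul_left _ _ _ _
  quad_mul_right _ _ _ _ := q.quad_mul_right _ _ _ _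
  quad_self _ b := by rw [q.quad_self, f.comm_P]

end QuadraticMap

namespace Tensor

theorem eq_top {N : AddSubgroup (M.Tensor G)} (hl : ∀ g a, univ.lin g a ∈ N)
    (hq : ∀ g h b, univ.quad g h b ∈ N) : N = ⊤ := by
  refine (AddSubgroup.eq_top_iff' N).2 fun x => ?_
  obtain ⟨x, rfl⟩ := QuotientAddGroup.mk'_surjective _ x
  change Tensor.mk M G x ∈ N
  induction x using FreeAbelianGroup.induction_on with
  | zero => rw [map_zero]; exact N.zero_mem
  | of x =>
    obtain ⟨g, a⟩ | ⟨g, h, b⟩ := x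
    · exact hl g a
    · exact hq g h b
  | neg x hx => rw [map_neg]; exact N.neg_mem hx
  | add x y hx hy => rw [map_add]; exact N.add_mem hx hy

/-- The tensor product is generated by the symbols on a generating set of the group. -/
theorem eq_top_of_closure {S : Set G} (hS : Subgroup.closure S = ⊤) {N : AddSubgroup (M.Tensor G)}
    (hl : ∀ s ∈ S, ∀ a, univ.lin s a ∈ N) (hq : ∀ s ∈ S, ∀ t ∈ S, ∀ b, univ.quad s t b ∈ N) :
    N = ⊤ :=
  have h := univ.mem_of_closure hS hl hq
  eq_top h.1 h.2

variable {A : Type u} [AddCommGroup A]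

theorem hom_ext_of_closure {S : Set G} (hS : Subgroup.closure S = ⊤) {f f' : M.Tensor G →+ A}
    (hl : ∀ s ∈ S, ∀ a, f (univ.lin s a) = f' (univ.lin s a))
    (hq : ∀ s ∈ S, ∀ t ∈ S, ∀ b, f (univ.quad s t b) = f' (univ.quad s t b)) : f = f' :=
  AddMonoidHom.eq_of_eqOn_top fun x _ => by
    have : f.eqLocus f' = ⊤ := eq_top_of_closure hS hl hq
    exact (this ▸ AddSubgroup.mem_top x : x ∈ f.eqLocus f')

@[ext]
theorem hom_ext {f f' : M.Tensor G →+ A} (hl : ∀ g a, f (univ.lin g a) = f' (univ.lin g a))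
    (hq : ∀ g h b, f (univ.quad g h b) = f' (univ.quad g h b)) : f = f' :=
  hom_ext_of_closure (S := Set.univ) (Subgroup.closure_univ) (fun g _ => hl g)
    (fun g _ h _ => hq g h)

variable {G' : Type u} [Group G'] {N : SquareGroup.{u}}

variable (M) in
/-- The map of tensor products induced by a homomorphism of groups. -/
def map (f : G →* G') : M.Tensor G →+ M.Tensor G' := (univ.comp f).lift

@[simp] theorem map_lin (f : G →* G') (g : G) (a : M.e) :
    map M f (univ.lin g a) = univ.lin (f g) a := QuadraticMap.lift_lin _ _ _

@[simp] theorem map_quad (f : G →* G') (g h : G) (b : M.ee) :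
    map M f (univ.quad g h b) = univ.quad (f g) (f h) b := QuadraticMap.lift_quad _ _ _ _

variable (G) in
/-- The map of tensor products induced by a morphism of square groups. -/
def mapHom (f : M ⟶ N) : M.Tensor G →+ N.Tensor G := (univ.compHom f).lift

@[simp] theorem mapHom_lin (f : M ⟶ N) (g : G) (a : M.e) :
    mapHom G f (univ.lin g a) = univ.lin g (f.e a) := QuadraticMap.lift_lin _ _ _

@[simp] theorem mapHom_quad (f : M ⟶ N) (g h : G) (b : M.ee) :
    mapHom G f (univ.quad g h b) = univ.quad g h (f.ee b) := QuadraticMap.lift_quad _ _ _ _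

/-- An element killed by three endomorphisms of a group, each of which annihilates a third part
of a generating set and fixes the rest, is zero. -/
theorem eq_zero_of_three {S : Set G} (hS : Subgroup.closure S = ⊤) {e₁ e₂ e₃ : G →* G}
    (he : ∀ s ∈ S, (e₁ s = 1 ∧ e₂ s = s ∧ e₃ s = s) ∨ (e₁ s = s ∧ e₂ s = 1 ∧ e₃ s = s) ∨
      (e₁ s = s ∧ e₂ s = s ∧ e₃ s = 1))
    {z : M.Tensor G} (h₁ : map M e₁ z = 0) (h₂ : map M e₂ z = 0) (h₃ : map M e₃ z = 0) :
    z = 0 := by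
  -- A symbol involves at most two generators, hence at most two of the three parts, and the
  -- endomorphism annihilating a remaining part fixes it. So the product of the three differences `1
  -- - eᵢ` kills every symbol, while each difference fixes `z`.
  let D (e : G →* G) : M.Tensor G →+ M.Tensor G := AddMonoidHom.id _ - map M e
  have hD : (D e₁).comp ((D e₂).comp (D e₃)) = 0 := by
    refine hom_ext_of_closure hS (fun s hs a => ?_) (fun s hs t ht b => ?_)
    · obtain ⟨h₁, h₂, h₃⟩ | ⟨h₁, h₂, h₃⟩ | ⟨h₁, h₂, h₃⟩ := he s hs <;>
      simp [D, h₁, h₂, h₃]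
    · obtain ⟨h₁, h₂, h₃⟩ | ⟨h₁, h₂, h₃⟩ | ⟨h₁, h₂, h₃⟩ := he s hs <;>
      obtain ⟨k₁, k₂, k₃⟩ | ⟨k₁, k₂, k₃⟩ | ⟨k₁, k₂, k₃⟩ := he t ht <;>
      simp [D, h₁, h₂, h₃, k₁, k₂, k₃]
  have := DFunLike.congr_fun hD z
  simpa [D, h₁, h₂, h₃] using this

end Tensor

end Tensor

/-- The functor `- ⊗ M` from groups to abelian groups. -/
def tensorFunctor (M : SquareGroup.{u}) : GrpCat.{u} ⥤ AddCommGrpCat.{u} where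
  obj G := AddCommGrpCat.of (M.Tensor G)
  map f := AddCommGrpCat.ofHom (Tensor.map M f.hom)
  map_id G := by ext : 1; exact Tensor.hom_ext (by simp) (by simp)
  map_comp f g := by ext : 1; exact Tensor.hom_ext (by simp) (by simp)

/-- The natural transformation of tensor product functors induced by a morphism of square
groups. -/
def tensorTrans {M N : SquareGroup.{u}} (f : M ⟶ N) : M.tensorFunctor ⟶ N.tensorFunctor where
  app G := AddCommGrpCat.ofHom (Tensor.mapHom G f)
  naturality G G' g := by
    ext : 1
    change (Tensor.mapHom G' f).comp (Tensor.map M g.hom) =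
      (Tensor.map N g.hom).comp (Tensor.mapHom G f)
    exact Tensor.hom_ext (by simp) (by simp)

theorem tensorTrans_id (M : SquareGroup.{u}) : tensorTrans (𝟙 M) = 𝟙 M.tensorFunctor := by
  ext G : 2
  refine AddCommGrpCat.hom_ext (Tensor.hom_ext (fun x a => ?_) (fun x y b => ?_))
  · exact Tensor.mapHom_lin (𝟙 M) x a
  · exact Tensor.mapHom_quad (𝟙 M) x y b

theorem tensorTrans_comp {M N L : SquareGroup.{u}} (f : M ⟶ N) (g : N ⟶ L) :
    tensorTrans (f ≫ g) = tensorTrans f ≫ tensorTrans g := by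
  ext G : 2
  rw [NatTrans.comp_app]
  refine AddCommGrpCat.hom_ext (Tensor.hom_ext (fun x a => ?_) (fun x y b => ?_))
  · change Tensor.mapHom G (f ≫ g) (Tensor.univ.lin x a) =
      Tensor.mapHom G g (Tensor.mapHom G f (Tensor.univ.lin x a))
    rw [Tensor.mapHom_lin, Tensor.mapHom_lin, Tensor.mapHom_lin]
    rfl
  · change Tensor.mapHom G (f ≫ g) (Tensor.univ.quad x y b) =
      Tensor.mapHom G g (Tensor.mapHom G f (Tensor.univ.quad x y b))
    rw [Tensor.mapHom_quad, Tensor.mapHom_quad, Tensor.mapHom_quad]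
    rfl

end SquareGroup

/-! ### Categories with a free cogroup -/

section CogroupModel

variable {C : Type v} [Category.{w} C] [HasZeroMorphisms C] [HasBinaryCoproducts C]

/-- A functor to groups represented by a cogroup `E`, together with the facts that `E` and
`E ∨ E` correspond to free groups and that the group of a sum is generated by the groups of its
summands. -/
structure CogroupModel {E : C} (c : Comult E) where
  U : C ⥤ GrpCat.{u}
  gen : U.obj E
  pt : ∀ {X : C}, U.obj X → (E ⟶ X)
  map_pt : ∀ {X : C} (x : U.obj X), U.map (pt x) gen = x
  pt_ext : ∀ {X : C} {f g : E ⟶ X}, U.map f gen = U.map g gen → f = g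
  map_μ : U.map c.μ gen =
    U.map (coprod.inl : E ⟶ E ⨿ E) gen * U.map (coprod.inr : E ⟶ E ⨿ E) gen
  map_zero : ∀ {X Y : C} (x : U.obj X), U.map (0 : X ⟶ Y) x = 1
  closure_gen : Subgroup.closure {gen} = ⊤
  closure_coprod : ∀ X Y : C, Subgroup.closure (Set.range (U.map (coprod.inl : X ⟶ X ⨿ Y)) ∪
    Set.range (U.map (coprod.inr : Y ⟶ X ⨿ Y))) = ⊤
  -- Freeness of `U(E)` and `U(E ∨ E)` serves only to define homomorphisms into central extensions,
  -- for the injectivity of the unit.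
  lift₁ : ∀ (K : Type u) [Group K] (k : K), ∃ f : U.obj E →* K, f gen = k
  lift₂ : ∀ (K : Type u) [Group K] (k l : K), ∃ f : U.obj (E ⨿ E) →* K,
    f (U.map (coprod.inl : E ⟶ E ⨿ E) gen) = k ∧ f (U.map (coprod.inr : E ⟶ E ⨿ E) gen) = l

namespace CogroupModel

variable {E : C} {c : Comult E} (m : CogroupModel.{u} c)

theorem map_map {X Y Z : C} (f : X ⟶ Y) (g : Y ⟶ Z) (x : m.U.obj X) :
    m.U.map g (m.U.map f x) = m.U.map (f ≫ g) x := by simp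

theorem map_id {X : C} (x : m.U.obj X) : m.U.map (𝟙 X) x = x := by simp

theorem pt_map {X Y : C} (x : m.U.obj X) (f : X ⟶ Y) : m.pt (m.U.map f x) = m.pt x ≫ f :=
  m.pt_ext (by rw [m.map_pt, ← m.map_map, m.map_pt])

theorem pt_gen : m.pt m.gen = 𝟙 E :=
  m.pt_ext (by rw [m.map_pt, m.map_id])

theorem pt_mul {X : C} (x y : m.U.obj X) :
    m.pt (x * y) = c.μ ≫ coprod.desc (m.pt x) (m.pt y) :=
  m.pt_ext (by
    rw [m.map_pt, ← m.map_map, m.map_μ, map_mul, m.map_map, m.map_map, coprod.inl_desc,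
      coprod.inr_desc, m.map_pt, m.map_pt])

/-- The first generator of the group of `E ∨ E`. -/
noncomputable abbrev gen₁ : m.U.obj (E ⨿ E) := m.U.map (coprod.inl : E ⟶ E ⨿ E) m.gen

/-- The second generator of the group of `E ∨ E`. -/
noncomputable abbrev gen₂ : m.U.obj (E ⨿ E) := m.U.map (coprod.inr : E ⟶ E ⨿ E) m.gen

theorem range_le_closure {X : C} (f : E ⟶ X) {S : Set (m.U.obj X)} (h : m.U.map f m.gen ∈ S) :
    Set.range (m.U.map f) ⊆ Subgroup.closure S := by
  rintro _ ⟨x, rfl⟩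
  have hx : x ∈ Subgroup.closure {m.gen} := m.closure_gen ▸ Subgroup.mem_top x
  have : Subgroup.closure {m.gen} ≤ (Subgroup.closure S).comap (m.U.map f).hom :=
    (Subgroup.closure_le _).2 (Set.singleton_subset_iff.2 (Subgroup.subset_closure h))
  exact this hx

theorem closure_gen₂ : Subgroup.closure {m.gen₁, m.gen₂} = ⊤ := by
  rw [eq_top_iff, ← m.closure_coprod E E, Subgroup.closure_le]
  exact Set.union_subset (m.range_le_closure _ (by simp)) (m.range_le_closure _ (by simp))

/-- The functor `X ↦ U(X) ⊗ M`. -/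
abbrev tensor (M : SquareGroup.{u}) : C ⥤ AddCommGrpCat.{u} := m.U ⋙ M.tensorFunctor

open SquareGroup

variable (M : SquareGroup.{u})

theorem tensor_map {X Y : C} (f : X ⟶ Y) (x : M.Tensor (m.U.obj X)) :
    (m.tensor M).map f x = Tensor.map M (m.U.map f).hom x := rfl

theorem tensor_map_lin {X Y : C} (f : X ⟶ Y) (g : m.U.obj X) (a : M.e) :
    (m.tensor M).map f (Tensor.univ.lin g a : M.Tensor (m.U.obj X)) =
      (Tensor.univ.lin (m.U.map f g) a : M.Tensor (m.U.obj Y)) := Tensor.map_lin _ _ _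

theorem tensor_map_quad {X Y : C} (f : X ⟶ Y) (g h : m.U.obj X) (b : M.ee) :
    (m.tensor M).map f (Tensor.univ.quad g h b : M.Tensor (m.U.obj X)) =
      (Tensor.univ.quad (m.U.map f g) (m.U.map f h) b : M.Tensor (m.U.obj Y)) :=
  Tensor.map_quad _ _ _ _

/-- The identity of the zero object is null, so it sends every group element to `1`, where all
symbols vanish. -/
theorem isReduced_tensor [HasZeroObject C] : IsReducedFunctor (m.tensor M) := by
  rw [IsReducedFunctor, IsZero.iff_id_eq_zero, ← CategoryTheory.Functor.map_id,
    (IsZero.iff_id_eq_zero _).1 (isZero_zero C)]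
  ext : 1
  refine Tensor.hom_ext (fun g a => ?_) (fun g h b => ?_)
  · refine (m.tensor_map_lin M 0 g a).trans ?_
    rw [m.map_zero]
    exact QuadraticMap.lin_one _ _
  · refine (m.tensor_map_quad M 0 g h b).trans ?_
    rw [m.map_zero]
    exact QuadraticMap.quad_one_left _ _ _

theorem closure_coprod₃ (X Y Z : C) : Subgroup.closure
    (Set.range (m.U.map ((coprod.inl : X ⟶ X ⨿ Y) ≫ (coprod.inl : X ⨿ Y ⟶ (X ⨿ Y) ⨿ Z))) ∪
      Set.range (m.U.map ((coprod.inr : Y ⟶ X ⨿ Y) ≫ (coprod.inl : X ⨿ Y ⟶ (X ⨿ Y) ⨿ Z))) ∪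
      Set.range (m.U.map (coprod.inr : Z ⟶ (X ⨿ Y) ⨿ Z))) = ⊤ := by
  set S := Set.range (m.U.map ((coprod.inl : X ⟶ X ⨿ Y) ≫ (coprod.inl : X ⨿ Y ⟶ (X ⨿ Y) ⨿ Z))) ∪
      Set.range (m.U.map ((coprod.inr : Y ⟶ X ⨿ Y) ≫ (coprod.inl : X ⨿ Y ⟶ (X ⨿ Y) ⨿ Z))) ∪
      Set.range (m.U.map (coprod.inr : Z ⟶ (X ⨿ Y) ⨿ Z)) with hS
  rw [eq_top_iff, ← m.closure_coprod (X ⨿ Y) Z, Subgroup.closure_le]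
  refine Set.union_subset ?_ (subset_trans ?_ Subgroup.subset_closure)
  · rintro _ ⟨x, rfl⟩
    have hx : x ∈ (⊤ : Subgroup (m.U.obj (X ⨿ Y))) := Subgroup.mem_top x
    rw [← m.closure_coprod X Y] at hx
    refine (?_ : Subgroup.closure _ ≤ (Subgroup.closure S).comap
      (m.U.map (coprod.inl : X ⨿ Y ⟶ (X ⨿ Y) ⨿ Z)).hom) hx
    rw [Subgroup.closure_le]
    rintro _ (⟨x, rfl⟩ | ⟨x, rfl⟩)
    · exact Subgroup.subset_closure (Or.inl (Or.inl ⟨x, (m.map_map _ _ _).symm⟩))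
    · exact Subgroup.subset_closure (Or.inl (Or.inr ⟨x, (m.map_map _ _ _).symm⟩))
  · exact Set.subset_union_right

theorem isQuadratic_tensor : IsQuadraticFunctor (m.tensor M) := by
  intro X Y Z
  rw [eq_bot_iff]
  intro z hz
  obtain ⟨h₁, h₂⟩ := (mem_crossEffect _ z).1 hz
  obtain ⟨-, h₃⟩ := (mem_crossEffect _ z.1).1 z.2
  have h₁' : (m.tensor M).map (coprod.map (retr₁ X Y) (𝟙 Z)) z.1 = 0 := congrArg Subtype.val h₁
  have h₂' : (m.tensor M).map (coprod.map (retr₂ X Y) (𝟙 Z)) z.1 = 0 := congrArg Subtype.val h₂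
  have h₃' : (m.tensor M).map (retr₁ (X ⨿ Y) Z) z.1 = 0 := ((mem_crossEffect _ z.1).1 z.2).1
  -- A retraction that forgets one summand, followed by the inclusion of the others, is an
  -- endomorphism of `X ∨ Y ∨ Z` as required by `Tensor.eq_zero_of_three`.
  have key {W : C} (f : (X ⨿ Y) ⨿ Z ⟶ W) (g : W ⟶ (X ⨿ Y) ⨿ Z)
      (h : (m.tensor M).map f z.1 = 0) : Tensor.map M (m.U.map (f ≫ g)).hom z.1 = 0 := by
    refine (functor_map_comp_apply (m.tensor M) f g z.1).symm.trans ?_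
    rw [h]
    exact _root_.map_zero _
  refine Subtype.ext (Tensor.eq_zero_of_three (m.closure_coprod₃ X Y Z) ?_
    (key _ (coprod.map coprod.inr (𝟙 Z)) h₂') (key _ (coprod.map coprod.inl (𝟙 Z)) h₁')
    (key _ coprod.inl h₃'))
  have ev {W V : C} (f : W ⟶ V) (e : V ⟶ V) (x : m.U.obj W) :
    (m.U.map e).hom (m.U.map f x) = m.U.map (f ≫ e) x := m.map_map f e x
  have one {W V : C} (f : W ⟶ V) (h : f = 0) (x : m.U.obj W) : m.U.map f x = 1 := by
    rw [h, m.map_zero]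
  have fix {W V : C} (f g : W ⟶ V) (h : f = g) (x : m.U.obj W) : m.U.map f x = m.U.map g x := by
    rw [h]
  rintro _ ((⟨x, rfl⟩ | ⟨x, rfl⟩) | ⟨x, rfl⟩) <;> simp only [ev]
  · refine Or.inl ⟨one _ ?_ x, fix _ _ ?_ x, fix _ _ ?_ x⟩ <;> simp [retr₁, retr₂, coprod.inl_desc]
  · refine Or.inr (Or.inl ⟨fix _ _ ?_ x, one _ ?_ x, fix _ _ ?_ x⟩) <;>
    simp [retr₁, retr₂, coprod.inr_desc, coprod.inl_desc]
  · refine Or.inr (Or.inr ⟨fix _ _ ?_ x, fix _ _ ?_ x, one _ ?_ x⟩) <;>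
    simp [retr₁, coprod.inr_desc]

theorem reducedQuadratic_tensor [HasZeroObject C] : reducedQuadratic C (m.tensor M) :=
  ⟨m.isReduced_tensor M, m.isQuadratic_tensor M⟩

end CogroupModel

end CogroupModel

/-! ### Central extensions by bilinear cocycles -/

/-- The central extension of `V` by `A` with bilinear cocycle `β`. -/
@[ext]
structure BilinearExtension {V : Type v} {A : Type u} [AddCommGroup V] [AddCommGroup A]
    (β : V →+ V →+ A) where
  fst : V
  snd : A

namespace BilinearExtension

variable {V : Type v} {A : Type u} [AddCommGroup V] [AddCommGroup A] {β : V →+ V →+ A}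

instance : Mul (BilinearExtension β) := ⟨fun x y => ⟨x.fst + y.fst, x.snd + y.snd + β x.fst y.fst⟩⟩

instance : One (BilinearExtension β) := ⟨⟨0, 0⟩⟩

/-- The term `β(v, v)` cancels the cocycle value `β(-v, v)`. -/
instance : Inv (BilinearExtension β) := ⟨fun x => ⟨-x.fst, -x.snd + β x.fst x.fst⟩⟩

@[simp] theorem fst_mul (x y : BilinearExtension β) : (x * y).fst = x.fst + y.fst := rfl

@[simp] theorem snd_mul (x y : BilinearExtension β) :
    (x * y).snd = x.snd + y.snd + β x.fst y.fst := rfl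

@[simp] theorem fst_one : (1 : BilinearExtension β).fst = 0 := rfl

@[simp] theorem snd_one : (1 : BilinearExtension β).snd = 0 := rfl

@[simp] theorem fst_inv (x : BilinearExtension β) : x⁻¹.fst = -x.fst := rfl

@[simp] theorem snd_inv (x : BilinearExtension β) : x⁻¹.snd = -x.snd + β x.fst x.fst := rfl

instance : Group (BilinearExtension β) :=
  Group.ofLeftAxioms
    (fun x y z => by
      ext
      · simp [add_assoc]
      · simp only [snd_mul, fst_mul, map_add, AddMonoidHom.add_apply]; abel)
    (fun x => by ext <;> simp)
    (fun x => by ext <;> simp)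

end BilinearExtension

namespace SquareGroup

variable {M : SquareGroup.{u}}

/-- The group `M_e` of a square group with linear `H` is commutative. -/
abbrev commGroup (hM : linear M) : AddCommGroup M.e :=
  { M.group_e with
    add_comm := fun x y => by
      -- The commutator is `P` of the cross effect of `H`, which vanishes.
      have h := M.P_cross x y
      rw [show mapCross M.H x y = 0 by rw [mapCross, hM]; abel, map_zero] at h
      have h' : y + x + (-x - y + x + y) = y + x := by rw [← h, add_zero]
      rw [← h']
      simp only [sub_eq_add_neg, add_assoc, add_neg_cancel_left] }

/-- The homomorphism `H` of a square group with linear `H`. -/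
def linearH (hM : linear M) : M.e →+ M.ee := AddMonoidHom.mk' M.H hM

end SquareGroup

/-! ### The unit: a square group with linear `H` is recovered from its tensor product functor -/

section CogroupModel

variable {C : Type v} [Category.{w} C] [HasZeroMorphisms C] [HasBinaryCoproducts C]

namespace CogroupModel

variable {E : C} {c : Comult E} (m : CogroupModel.{u} c)

open SquareGroup

variable (M : SquareGroup.{u})

/-- On the powers of the generator the quadratic map is `lin(xⁿ, a) = n a + (n choose 2) PH(a)` and
`quad(xᵐ, xⁿ, b) = mn P(b)`. The deviation of `lin` from additivity is the bilinear form `β`, so a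
homomorphism from the free group into the extension by `β` provides the degree `n` and the map
`lin(xⁿ, -)` without binomial coefficients. -/
theorem exists_retraction_lin (hM : linear M) : ∃ f : M.Tensor (m.U.obj E) →+ M.e,
    ∀ a, f (Tensor.univ.lin m.gen a) = a := by
  let : AddCommGroup M.e := commGroup hM
  let PH : M.e →+ M.e := M.P.comp (linearH hM)
  let β : ℤ →+ ℤ →+ (M.e →+ M.e) := (AddMonoidHom.mul : ℤ →+ ℤ →+ ℤ).compr₂ (zmultiplesHom _ PH)
  have hβ (x y : ℤ) (a : M.e) : β x y a = (x * y) • M.P (M.H a) := rfl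
  obtain ⟨f, hf⟩ := m.lift₁ (BilinearExtension β) ⟨1, AddMonoidHom.id _⟩
  -- The relation `quad_self`: since `PHP = 2P`, the value `n P(b) + (n choose 2) PHP(b)` is `n²
  -- P(b)`. It is checked by induction over words.
  have key (g : m.U.obj E) :
      ∀ b, ((f g).fst * (f g).fst) • M.P b = (f g).snd (M.P b) := by
    have hg : g ∈ Subgroup.closure {m.gen} := m.closure_gen ▸ Subgroup.mem_top g
    induction hg using Subgroup.closure_induction with
    | mem s hs => obtain rfl := hs; intro b; simp [hf]
    | one => simp
    | mul x y _ _ hx hy =>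
      intro b
      simp only [map_mul, BilinearExtension.fst_mul, BilinearExtension.snd_mul,
        AddMonoidHom.add_apply, hβ, M.P_H_P, ← hx, ← hy]
      module
    | inv x _ hx =>
      intro b
      simp only [map_inv, BilinearExtension.fst_inv, BilinearExtension.snd_inv,
        AddMonoidHom.add_apply, AddMonoidHom.neg_apply, hβ, M.P_H_P, ← hx]
      module
  let q : M.QuadraticMap (m.U.obj E) M.e :=
    { lin := fun g a => (f g).snd a
      quad := fun g h b => ((f g).fst * (f h).fst) • M.P b
      lin_add := fun g => map_add _
      quad_add := fun g h b b' => by rw [map_add, smul_add]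
      lin_mul := fun g h a => by
        simp only [map_mul, BilinearExtension.snd_mul, AddMonoidHom.add_apply, hβ]
      quad_mul_left := fun g g' h b => by
        simp only [map_mul, BilinearExtension.fst_mul, add_mul, add_smul]
      quad_mul_right := fun g h h' b => by
        simp only [map_mul, BilinearExtension.fst_mul, mul_add, add_smul]
      quad_self := key }
  refine ⟨q.lift, fun a => ?_⟩
  rw [q.lift_lin]
  change (f m.gen).snd a = a
  rw [hf]
  rfl

/-- The wanted values are `quad(x₁, x₂, b) = b` and zero for `lin` on both generators. Then
`quad_self` forces `quad(xᵢ, xᵢ, -) = 0` and `quad_swap` forces `quad(x₂, x₁, b) = HP(b) - b`, which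
is `T b`. The extension of `ℤ × ℤ` by `β` again yields `lin`. -/
theorem exists_retraction_quad (hM : linear M) : ∃ f : M.Tensor (m.U.obj (E ⨿ E)) →+ M.ee,
    ∀ b, f (Tensor.univ.quad m.gen₁ m.gen₂ b) = b := by
  let H := linearH hM
  let T : M.ee →+ M.ee := H.comp M.P - AddMonoidHom.id _
  have hT (b : M.ee) : T b = M.H (M.P b) - b := rfl
  -- The identity `T ∘ HP = HP` makes the relation `quad_self` propagate to products in `key`.
  have hTH (b : M.ee) : T (M.H (M.P b)) = M.H (M.P b) := by
    rw [hT, M.P_H_P, two_nsmul, hM, add_sub_cancel_right]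
  let β : ℤ × ℤ →+ ℤ × ℤ →+ (M.e →+ M.ee) :=
    ((AddMonoidHom.mul.comp (AddMonoidHom.fst ℤ ℤ)).compl₂ (AddMonoidHom.snd ℤ ℤ)).compr₂
      (zmultiplesHom _ H) +
    ((AddMonoidHom.mul.comp (AddMonoidHom.snd ℤ ℤ)).compl₂ (AddMonoidHom.fst ℤ ℤ)).compr₂
      (zmultiplesHom _ (T.comp H))
  have hβ (x y : ℤ × ℤ) (a : M.e) :
      β x y a = (x.1 * y.2) • M.H a + (x.2 * y.1) • T (M.H a) := rfl
  obtain ⟨f, hf₁, hf₂⟩ := m.lift₂ (BilinearExtension β) ⟨(1, 0), 0⟩ ⟨(0, 1), 0⟩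
  have key (g : m.U.obj (E ⨿ E)) : ∀ b, ((f g).fst.1 * (f g).fst.2) • b +
      ((f g).fst.2 * (f g).fst.1) • T b = (f g).snd (M.P b) := by
    have hg : g ∈ Subgroup.closure {m.gen₁, m.gen₂} := m.closure_gen₂ ▸ Subgroup.mem_top g
    induction hg using Subgroup.closure_induction with
    | mem s hs =>
      intro b
      obtain rfl | rfl := hs
      · rw [hf₁]; simp
      · rw [hf₂]; simp
    | one => simp
    | mul x y _ _ hx hy =>
      intro b
      simp only [map_mul, BilinearExtension.fst_mul, BilinearExtension.snd_mul,
        AddMonoidHom.add_apply, hβ, hTH, ← hx, ← hy, Prod.fst_add, Prod.snd_add]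
      rw [hT]
      module
    | inv x _ hx =>
      intro b
      simp only [map_inv, BilinearExtension.fst_inv, BilinearExtension.snd_inv,
        AddMonoidHom.add_apply, AddMonoidHom.neg_apply, hβ, hTH, ← hx, Prod.fst_neg, Prod.snd_neg]
      rw [hT]
      module
  let q : M.QuadraticMap (m.U.obj (E ⨿ E)) M.ee :=
    { lin := fun g a => (f g).snd a
      quad := fun g h b => ((f g).fst.1 * (f h).fst.2) • b + ((f g).fst.2 * (f h).fst.1) • T b
      lin_add := fun g => map_add _
      quad_add := fun g h b b' => by rw [map_add]; module
      lin_mul := fun g h a => by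
        simp only [map_mul, BilinearExtension.snd_mul, AddMonoidHom.add_apply, hβ]
      quad_mul_left := fun g g' h b => by
        simp only [map_mul, BilinearExtension.fst_mul, Prod.fst_add, Prod.snd_add]; module
      quad_mul_right := fun g h h' b => by
        simp only [map_mul, BilinearExtension.fst_mul, Prod.fst_add, Prod.snd_add]; module
      quad_self := key }
  refine ⟨q.lift, fun b => ?_⟩
  rw [q.lift_quad]
  change ((f m.gen₁).fst.1 * (f m.gen₂).fst.2) • b + ((f m.gen₁).fst.2 * (f m.gen₂).fst.1) • T b = b
  rw [hf₁, hf₂]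
  simp

/-- The only other symbols on a single generator have the form `quad(x, x, b)`, and `quad_self`
absorbs them. -/
theorem exists_lin_eq (z : M.Tensor (m.U.obj E)) : ∃ a, Tensor.univ.lin m.gen a = z := by
  have : (AddMonoidHom.mk' (Tensor.univ.lin m.gen) (Tensor.univ.lin_add (M := M) m.gen)).range =
      ⊤ := by
    refine Tensor.eq_top_of_closure m.closure_gen ?_ ?_
    · rintro _ rfl a
      exact ⟨a, rfl⟩
    · rintro _ rfl _ rfl b
      exact ⟨M.P b, (Tensor.univ.quad_self _ _).symm⟩
  exact (this ▸ AddSubgroup.mem_top z : z ∈ AddMonoidHom.range _)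

/-- Both sides of `quad_self` at `g * h` are expanded; after cancelling the diagonal terms, the two
mixed terms add up to `quad(g, h, HP(b))`. -/
theorem quad_swap {G : Type u} [Group G] {A : Type u} [AddCommGroup A] (q : M.QuadraticMap G A)
    (g h : G) (b : M.ee) : q.quad h g b = q.quad g h (M.H (M.P b) - b) := by
  have h₁ := q.quad_self (g * h) b
  rw [q.quad_mul_left, q.quad_mul_right, q.quad_mul_right, q.lin_mul, q.quad_self, q.quad_self]
    at h₁
  have h₂ := q.quad_add g h (M.H (M.P b) - b) b
  rw [sub_add_cancel] at h₂
  rw [h₂, ← sub_eq_zero] at h₁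
  rw [← sub_eq_zero, ← h₁]
  abel

/-- Symbols on the two generators reduce to three kinds: `quad_self` removes the diagonal ones and
`quad_swap` the pair in the wrong order. -/
theorem exists_eq_add_add (z : M.Tensor (m.U.obj (E ⨿ E))) :
    ∃ a a' b, z = Tensor.univ.lin m.gen₁ a + Tensor.univ.lin m.gen₂ a' +
      Tensor.univ.quad m.gen₁ m.gen₂ b := by
  let q : M.QuadraticMap (m.U.obj (E ⨿ E)) _ := Tensor.univ
  let N : AddSubgroup (M.Tensor (m.U.obj (E ⨿ E))) :=
    (AddMonoidHom.mk' (q.lin m.gen₁) (q.lin_add m.gen₁)).range ⊔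
      (AddMonoidHom.mk' (q.lin m.gen₂) (q.lin_add m.gen₂)).range ⊔
      (AddMonoidHom.mk' (q.quad m.gen₁ m.gen₂) (q.quad_add m.gen₁ m.gen₂)).range
  have l₁ (a : M.e) : q.lin m.gen₁ a ∈ N :=
    AddSubgroup.mem_sup_left (AddSubgroup.mem_sup_left ⟨a, rfl⟩)
  have l₂ (a : M.e) : q.lin m.gen₂ a ∈ N :=
    AddSubgroup.mem_sup_left (AddSubgroup.mem_sup_right ⟨a, rfl⟩)
  have l₃ (b : M.ee) : q.quad m.gen₁ m.gen₂ b ∈ N := AddSubgroup.mem_sup_right ⟨b, rfl⟩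
  have hN : N = ⊤ := by
    refine Tensor.eq_top_of_closure m.closure_gen₂ ?_ ?_
    · rintro _ (rfl | rfl) a
      · exact l₁ a
      · exact l₂ a
    · rintro _ (rfl | rfl) _ (rfl | rfl) b
      · rw [Tensor.univ.quad_self]; exact l₁ _
      · exact l₃ b
      · rw [quad_swap]; exact l₃ _
      · rw [Tensor.univ.quad_self]; exact l₂ _
  have hz : z ∈ N := hN ▸ AddSubgroup.mem_top z
  obtain ⟨_, hy, _, ⟨b, rfl⟩, rfl⟩ := AddSubgroup.mem_sup.1 hz
  obtain ⟨_, ⟨a, rfl⟩, _, ⟨a', rfl⟩, rfl⟩ := AddSubgroup.mem_sup.1 hy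
  exact ⟨a, a', b, rfl⟩

theorem quad_gen_mem (b : M.ee) :
    (Tensor.univ.quad m.gen₁ m.gen₂ b : M.Tensor (m.U.obj (E ⨿ E))) ∈
      crossEffect (m.tensor M) E E := by
  refine (mem_crossEffect (m.tensor M) _).2 ⟨?_, ?_⟩
  · rw [tensor_map_quad, m.map_map coprod.inr, retr₁, coprod.inr_desc, m.map_zero]
    exact QuadraticMap.quad_one_right _ _ _
  · rw [tensor_map_quad, m.map_map coprod.inl, retr₂, coprod.inl_desc, m.map_zero]
    exact QuadraticMap.quad_one_left _ _ _

variable [HasZeroObject C]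

/-- The morphism from a square group to the square group of its tensor product functor. -/
noncomputable def unitHom : M ⟶ squareObj (m.reducedQuadratic_tensor M) c where
  e := AddMonoidHom.mk' (Tensor.univ.lin m.gen) (Tensor.univ.lin_add (M := M) m.gen)
  ee := AddMonoidHom.mk' (fun b => ⟨Tensor.univ.quad m.gen₁ m.gen₂ b, m.quad_gen_mem M b⟩)
    (fun b b' => Subtype.ext (Tensor.univ.quad_add m.gen₁ m.gen₂ b b'))
  comm_H a := Subtype.ext (by
    refine Eq.trans ?_ (hopfMap_coe (m.isReduced_tensor M) c (Tensor.univ.lin m.gen a)).symm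
    -- As `μ` sends the generator to the product of the two generators, the compatibility with `H`
    -- is the relation `lin_mul`.
    rw [tensor_map_lin, tensor_map_lin, tensor_map_lin, m.map_μ, QuadraticMap.lin_mul]
    have h (x y z : M.Tensor (m.U.obj (E ⨿ E))) : z = x + y + z - x - y := by abel
    exact h _ _ _)
  comm_P b := by
    refine Eq.symm ((m.tensor_map_quad M (coprod.desc (𝟙 E) (𝟙 E)) m.gen₁ m.gen₂ b).trans ?_)
    rw [m.map_map, m.map_map, coprod.inl_desc, coprod.inr_desc, m.map_id, Tensor.univ.quad_self]
    rfl

theorem bijective_unitHom_e (hM : linear M) : Function.Bijective (m.unitHom M).e := by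
  obtain ⟨f, hf⟩ := m.exists_retraction_lin M hM
  exact ⟨Function.LeftInverse.injective hf, m.exists_lin_eq M⟩

theorem bijective_unitHom_ee (hM : linear M) : Function.Bijective (m.unitHom M).ee := by
  obtain ⟨f, hf⟩ := m.exists_retraction_quad M hM
  refine ⟨fun b b' h => ?_, fun z => ?_⟩
  · rw [← hf b, ← hf b']
    exact congrArg (fun x => f x.1) h
  -- The two retractions isolate the linear summands of `z`, so both are zero if `z` lies in the
  -- cross-effect, and only the mixed symbol remains.
  · obtain ⟨a, a', b, hz⟩ := m.exists_eq_add_add M z.1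
    refine ⟨b, Subtype.ext (Eq.trans ?_ hz.symm)⟩
    have hr (f : E ⨿ E ⟶ E) : (m.tensor M).map f (Tensor.univ.lin m.gen₁ a +
        Tensor.univ.lin m.gen₂ a' + Tensor.univ.quad m.gen₁ m.gen₂ b : M.Tensor _) =
        (Tensor.univ.lin (m.U.map (coprod.inl ≫ f) m.gen) a +
          Tensor.univ.lin (m.U.map (coprod.inr ≫ f) m.gen) a' +
          Tensor.univ.quad (m.U.map (coprod.inl ≫ f) m.gen)
            (m.U.map (coprod.inr ≫ f) m.gen) b : M.Tensor _) := by
      rw [tensor_map, map_add, map_add, Tensor.map_lin, Tensor.map_lin, Tensor.map_quad,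
        ← m.map_map, ← m.map_map]
    have h := (mem_crossEffect _ z.1).1 z.2
    rw [hz] at h
    obtain ⟨h₁, h₂⟩ := h
    have h₁ := (hr _).symm.trans h₁
    have h₂ := (hr _).symm.trans h₂
    simp only [retr₁, retr₂, coprod.inl_desc, coprod.inr_desc, m.map_zero, m.map_id,
      QuadraticMap.lin_one, QuadraticMap.quad_one_left, QuadraticMap.quad_one_right,
      zero_add, add_zero] at h₁ h₂
    have key (f : E ⟶ E ⨿ E) (a : M.e) (h : (Tensor.univ.lin m.gen a : M.Tensor _) = 0) :
        (Tensor.univ.lin (m.U.map f m.gen) a : M.Tensor _) = 0 :=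
      (Tensor.map_lin (m.U.map f).hom m.gen a).symm.trans (by rw [h, _root_.map_zero])
    rw [key _ a h₁, key _ a' h₂, zero_add, zero_add]
    rfl

end CogroupModel

end CogroupModel

/-! ### Natural transformations of reduced quadratic functors are detected on `E` and on the
cross-effect -/

open ZeroObject in
theorem isIso_app_of_isZero {C : Type v} [Category.{w} C] [HasZeroObject C]
    {F G : C ⥤ AddCommGrpCat.{u}} (hF : IsReducedFunctor F)
    (hG : IsReducedFunctor G) (η : F ⟶ G) {X : C} (hX : IsZero X) : IsIso (η.app X) := by
  rw [NatTrans.isIso_app_iff_of_iso η hX.isoZero]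
  exact ⟨0, hF.eq_of_src _ _, hG.eq_of_src _ _⟩

/-- This transfers additivity of the cross-effect from the first variable to the second. -/
theorem map_desc_swap {C : Type v} [Category.{w} C] [HasBinaryCoproducts C]
    {F : C ⥤ AddCommGrpCat.{u}} {X Y Z : C} (f : X ⟶ Z) (g : Y ⟶ Z) (b : F.obj (X ⨿ Y)) :
    F.map (coprod.desc f g) b =
      F.map (coprod.desc g f) (F.map (coprod.desc coprod.inr coprod.inl) b) := by
  rw [functor_map_comp_apply, coprod.desc_comp, coprod.inl_desc, coprod.inr_desc]

section CrossTrans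

variable {C : Type v} [Category.{w} C] [HasZeroMorphisms C] [HasBinaryCoproducts C]

/-- The natural transformation of cross-effects induced by a natural transformation. -/
noncomputable def crossTrans {F G : C ⥤ AddCommGrpCat.{u}} (η : F ⟶ G) (Y : C) :
    crossEffectLeft F Y ⟶ crossEffectLeft G Y where
  app X := AddCommGrpCat.ofHom (((η.app (X ⨿ Y)).hom.comp (crossEffect F X Y).subtype).codRestrict
    (crossEffect G X Y) (fun x => by
      have hx := (mem_crossEffect F x.1).1 x.2
      change η.app (X ⨿ Y) x.1 ∈ _
      rw [mem_crossEffect, ← NatTrans.naturality_apply, ← NatTrans.naturality_apply, hx.1, hx.2]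
      exact ⟨map_zero (η.app X).hom, map_zero (η.app Y).hom⟩))
  naturality X X' f := by
    ext x
    exact Subtype.ext (NatTrans.naturality_apply η (coprod.map f (𝟙 Y)) x.1)

theorem AddCommGrpCat.isIso_iff_bijective {A B : AddCommGrpCat.{u}} (f : A ⟶ B) :
    IsIso f ↔ Function.Bijective f := ConcreteCategory.isIso_iff_bijective f

variable [HasZeroObject C]

/-- The projection of `F(X ∨ Y)` onto `F(X | Y)` for a reduced functor `F`. -/
theorem sub_sub_mem_crossEffect {F : C ⥤ AddCommGrpCat.{u}} (hF : IsReducedFunctor F) {X Y : C}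
    (z : F.obj (X ⨿ Y)) : z - F.map coprod.inl (F.map (retr₁ X Y) z) -
      F.map coprod.inr (F.map (retr₂ X Y) z) ∈ crossEffect F X Y := by
  rw [mem_crossEffect]
  simp only [map_sub, functor_map_comp_apply, Category.assoc]
  have h₁ : (coprod.inl : X ⟶ X ⨿ Y) ≫ retr₁ X Y = 𝟙 X := by simp [retr₁, coprod.inl_desc]
  have h₂ : (coprod.inr : Y ⟶ X ⨿ Y) ≫ retr₁ X Y = 0 := by simp [retr₁, coprod.inr_desc]
  have h₃ : (coprod.inl : X ⟶ X ⨿ Y) ≫ retr₂ X Y = 0 := by simp [retr₂, coprod.inl_desc]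
  have h₄ : (coprod.inr : Y ⟶ X ⨿ Y) ≫ retr₂ X Y = 𝟙 Y := by simp [retr₂, coprod.inr_desc]
  simp only [h₁, h₂, h₃, h₄, comp_zero, Category.comp_id, map_zero_apply hF]
  simp

/-- A natural transformation to a reduced functor which is invertible at `X`, at `Y` and on the
cross-effect is invertible at `X ∨ Y`. -/
theorem isIso_app_coprod {F G : C ⥤ AddCommGrpCat.{u}} (hG : IsReducedFunctor G)
    (η : F ⟶ G) {X Y : C} (hX : IsIso (η.app X)) (hY : IsIso (η.app Y)) (h : Function.Bijective ((crossTrans η Y).app X)) :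
    IsIso (η.app (X ⨿ Y)) := by
  rw [AddCommGrpCat.isIso_iff_bijective] at hX hY ⊢
  have nat {V W : C} (f : V ⟶ W) (x : F.obj V) : η.app W (F.map f x) = G.map f (η.app V x) :=
    NatTrans.naturality_apply η f x
  constructor
  · rw [injective_iff_map_eq_zero]
    intro z hz
    have h₁ : F.map (retr₁ X Y) z = 0 := hX.1 (by rw [nat, hz, map_zero, map_zero])
    have h₂ : F.map (retr₂ X Y) z = 0 := hY.1 (by rw [nat, hz, map_zero, map_zero])
    -- An element of the kernel is killed by both retractions, so it lies in the cross-effect, where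
    -- injectivity is assumed.
    exact congrArg Subtype.val (h.1 (a₁ := (⟨z, h₁, h₂⟩ : crossEffect F X Y)) (a₂ := 0)
      (Subtype.ext (hz.trans (map_zero (η.app (X ⨿ Y)).hom).symm)))
  · intro z
    obtain ⟨x, hx⟩ := hX.2 (G.map (retr₁ X Y) z)
    obtain ⟨y, hy⟩ := hY.2 (G.map (retr₂ X Y) z)
    obtain ⟨w, hw⟩ := h.2 (⟨_, sub_sub_mem_crossEffect hG z⟩ : crossEffect G X Y)
    refine ⟨F.map coprod.inl x + F.map coprod.inr y + w.1, ?_⟩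
    rw [map_add, map_add, nat, nat, hx, hy]
    have hw' : η.app (X ⨿ Y) w.1 = z - G.map coprod.inl (G.map (retr₁ X Y) z) -
      G.map coprod.inr (G.map (retr₂ X Y) z) := congrArg Subtype.val hw
    rw [hw']
    abel

/-- The objects obtained from a zero object by finitely many sums with `E`. -/
inductive FinitelyFree (E : C) : C → Prop
  | zero {X : C} : IsZero X → FinitelyFree E X
  | coprod {X : C} : FinitelyFree E X → FinitelyFree E (X ⨿ E)
  | iso {X Y : C} : (X ≅ Y) → FinitelyFree E X → FinitelyFree E Y

/-- The values `F(X)` and `F(X | E)` are treated in a simultaneous induction. The step for `F` uses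
`F(X ∨ E) = F(X) ⊕ F(E) ⊕ F(X | E)`. The step for the cross-effect is the same decomposition applied
to `F(- | E)`, whose own cross-effect is zero because `F` is quadratic. -/
theorem isIso_app_of_finitelyFree {F G : C ⥤ AddCommGrpCat.{u}} (hF : reducedQuadratic C F)
    (hG : reducedQuadratic C G) (η : F ⟶ G) {E : C} (h : IsIso (η.app E))
    (h' : IsIso ((crossTrans η E).app E)) {X : C} (hX : FinitelyFree E X) :
    IsIso (η.app X) ∧ IsIso ((crossTrans η E).app X) := by
  induction hX with
  | zero hX =>
    exact ⟨isIso_app_of_isZero hF.1 hG.1 η hX, isIso_app_of_isZero (isReduced_crossEffectLeft F E)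
      (isReduced_crossEffectLeft G E) _ hX⟩
  | @coprod X _ ih =>
    refine ⟨isIso_app_coprod hG.1 η ih.1 h ((AddCommGrpCat.isIso_iff_bijective _).1 ih.2),
      isIso_app_coprod (isReduced_crossEffectLeft G E) _ ih.2 h'
        ⟨fun x y _ => ?_, fun y => ⟨0, ?_⟩⟩⟩
    · have h₀ (z : crossEffect (crossEffectLeft F E) X E) : z = 0 :=
        Subtype.ext ((hF.2 X E E).le z.2)
      exact (h₀ x).trans (h₀ y).symm
    · have h₀ (z : crossEffect (crossEffectLeft G E) X E) : z = 0 :=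
        Subtype.ext ((hG.2 X E E).le z.2)
      exact (h₀ _).trans (h₀ y).symm
  | iso e _ ih =>
    rwa [← NatTrans.isIso_app_iff_of_iso η e, ← NatTrans.isIso_app_iff_of_iso (crossTrans η E) e]

variable {E : C} {c : Comult E}

/-- The components of `squareHom` are, by definition, the components at `E` of `η` and of the
induced map on `F(- | E)`. -/
theorem isIso_app_of_bijective_squareHom {F G : C ⥤ AddCommGrpCat.{u}} (hF : reducedQuadratic C F)
    (hG : reducedQuadratic C G) {η : F ⟶ G} (h : Function.Bijective (squareHom hF hG c η).e)
    (h' : Function.Bijective (squareHom hF hG c η).ee) {X : C} (hX : FinitelyFree E X) :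
    IsIso (η.app X) :=
  (isIso_app_of_finitelyFree hF hG η ((AddCommGrpCat.isIso_iff_bijective _).2 h)
    ((AddCommGrpCat.isIso_iff_bijective _).2 h') hX).1

/-- The functor `F(- | Y)` is reduced with vanishing cross-effect, so its own map `H` is zero. -/
theorem map_comult_left {F : C ⥤ AddCommGrpCat.{u}} (hQ : IsQuadraticFunctor F) (c : Comult E)
    {Y : C} {x : F.obj (E ⨿ Y)} (hx : x ∈ crossEffect F E Y) :
    F.map (coprod.map c.μ (𝟙 Y)) x =
      F.map (coprod.map coprod.inl (𝟙 Y)) x + F.map (coprod.map coprod.inr (𝟙 Y)) x := by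
  let x' : (crossEffectLeft F Y).obj E := (⟨x, hx⟩ : crossEffect F E Y)
  have h := hopfMap_coe (isReduced_crossEffectLeft F Y) c x'
  rw [show hopfMap (isReduced_crossEffectLeft F Y) c x' = 0 from
    Subtype.ext ((hQ E E Y).le (hopfMap (isReduced_crossEffectLeft F Y) c x').2)] at h
  have h' := congrArg Subtype.val h
  change 0 = F.map (coprod.map c.μ (𝟙 Y)) x - F.map (coprod.map coprod.inl (𝟙 Y)) x -
    F.map (coprod.map coprod.inr (𝟙 Y)) x at h'
  rw [← sub_eq_zero, ← sub_sub]
  exact h'.symm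

/-! ### The counit `U(X) ⊗ F{E} → F(X)` -/

namespace CogroupModel

open SquareGroup

variable (m : CogroupModel.{u} c) {F : C ⥤ AddCommGrpCat.{u}} (hF : reducedQuadratic C F)

/-- The product of points is formed through `μ`, so this is the image of `map_comult_left` under the
morphism with components `x`, `x'` and `g`. -/
theorem map_desc_pt_mul (hQ : IsQuadraticFunctor F) {X Y : C} (x x' : m.U.obj X) (g : Y ⟶ X)
    {b : F.obj (E ⨿ Y)} (hb : b ∈ crossEffect F E Y) :
    F.map (coprod.desc (m.pt (x * x')) g) b =
      F.map (coprod.desc (m.pt x) g) b + F.map (coprod.desc (m.pt x') g) b := by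
  have h := congrArg (F.map (coprod.desc (coprod.desc (m.pt x) (m.pt x')) g))
    (map_comult_left hQ c hb)
  rw [map_add, functor_map_comp_apply, functor_map_comp_apply, functor_map_comp_apply,
    coprod.map_desc, coprod.map_desc, coprod.map_desc, ← m.pt_mul, Category.id_comp,
    coprod.inl_desc, coprod.inr_desc] at h
  exact h

/-- This is the definition of `H`, pushed forward along the morphism `E ∨ E ⟶ X` with components `x`
and `y`. -/
theorem map_pt_mul (hF : IsReducedFunctor F) {X : C} (x y : m.U.obj X) (a : F.obj E) :
    F.map (m.pt (x * y)) a = F.map (m.pt x) a + F.map (m.pt y) a +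
      F.map (coprod.desc (m.pt x) (m.pt y)) (hopfMap hF c a).1 := by
  rw [hopfMap_coe, map_sub, map_sub, functor_map_comp_apply, functor_map_comp_apply,
    functor_map_comp_apply, ← m.pt_mul, coprod.inl_desc, coprod.inr_desc]
  abel

/-- The quadratic map from the points of `X` to `F(X)`. -/
noncomputable def counitQuadratic (X : C) :
    (squareObj hF c).QuadraticMap (m.U.obj X) (F.obj X) where
  lin x a := F.map (m.pt x) a
  quad x y b := F.map (coprod.desc (m.pt x) (m.pt y)) b.1
  lin_add x := map_add (F.map (m.pt x)).hom
  quad_add x y b b' := map_add (F.map (coprod.desc (m.pt x) (m.pt y))).hom b.1 b'.1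
  lin_mul := m.map_pt_mul hF.1
  quad_mul_left x x' y b := m.map_desc_pt_mul hF.2 x x' (m.pt y) b.2
  quad_mul_right x y y' b := by
    rw [map_desc_swap, m.map_desc_pt_mul hF.2 y y' (m.pt x) (map_swap_mem b.2), ← map_desc_swap,
      ← map_desc_swap]
  quad_self x b := by
    change _ = F.map (m.pt x) (F.map (coprod.desc (𝟙 E) (𝟙 E)) b.1)
    rw [functor_map_comp_apply, coprod.desc_comp, Category.id_comp]

/-- The natural transformation `U(X) ⊗ F{E} ⟶ F(X)`. -/
noncomputable def counit : m.tensor (squareObj hF c) ⟶ F where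
  app X := AddCommGrpCat.ofHom (m.counitQuadratic hF X).lift
  naturality X Y f := by
    ext : 1
    refine Tensor.hom_ext (fun x a => ?_) (fun x y b => ?_)
    · change (m.counitQuadratic hF Y).lift ((m.tensor (squareObj hF c)).map f
        (Tensor.univ.lin x a)) = F.map f ((m.counitQuadratic hF X).lift (Tensor.univ.lin x a))
      rw [tensor_map_lin, QuadraticMap.lift_lin, QuadraticMap.lift_lin]
      change F.map (m.pt (m.U.map f x)) a = F.map f (F.map (m.pt x) a)
      rw [m.pt_map]
      exact (functor_map_comp_apply F (m.pt x) f a).symm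
    · change (m.counitQuadratic hF Y).lift ((m.tensor (squareObj hF c)).map f
        (Tensor.univ.quad x y b)) = F.map f ((m.counitQuadratic hF X).lift (Tensor.univ.quad x y b))
      rw [tensor_map_quad, QuadraticMap.lift_quad, QuadraticMap.lift_quad]
      change F.map (coprod.desc (m.pt (m.U.map f x)) (m.pt (m.U.map f y))) b.1 =
        F.map f (F.map (coprod.desc (m.pt x) (m.pt y)) b.1)
      rw [m.pt_map, m.pt_map, functor_map_comp_apply, coprod.desc_comp]

theorem counit_app_lin (X : C) (x : m.U.obj X) (a : F.obj E) :
    (m.counit hF).app X ((Tensor.univ (M := squareObj hF c)).lin x a) = F.map (m.pt x) a :=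
  QuadraticMap.lift_lin _ _ _

theorem counit_app_quad (X : C) (x y : m.U.obj X) (b : crossEffect F E E) :
    (m.counit hF).app X ((Tensor.univ (M := squareObj hF c)).quad x y b) =
      F.map (coprod.desc (m.pt x) (m.pt y)) b.1 :=
  QuadraticMap.lift_quad _ _ _ _

/-- One half of a triangle identity: the generator corresponds to the identity of `E`. -/
theorem squareHom_counit_unitHom_e (a : F.obj E) :
    (squareHom (m.reducedQuadratic_tensor _) hF c (m.counit hF)).e
      ((m.unitHom (squareObj hF c)).e a) = a := by
  refine (m.counit_app_lin hF E m.gen a).trans ?_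
  rw [m.pt_gen]
  simp

theorem squareHom_counit_unitHom_ee (b : crossEffect F E E) :
    (squareHom (m.reducedQuadratic_tensor _) hF c (m.counit hF)).ee
      ((m.unitHom (squareObj hF c)).ee b) = b := by
  refine Subtype.ext ((m.counit_app_quad hF (E ⨿ E) m.gen₁ m.gen₂ b).trans ?_)
  rw [m.pt_map, m.pt_map, m.pt_gen]
  simp

theorem linear_squareObj : linear (squareObj hF c) := map_add (hopfMap hF.1 c)

/-- By the triangle identities, the counit induces on square groups a left inverse of the bijective
unit, hence a bijection. This suffices on finitely free objects. -/
theorem isIso_counit_app {X : C} (hX : FinitelyFree E X) : IsIso ((m.counit hF).app X) := by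
  have key {A B : Type u} {f : A → B} {g : B → A} (hg : Function.Bijective g)
      (h : ∀ x, f (g x) = x) : Function.Bijective f :=
    (Function.Bijective.of_comp_iff f hg).1 (by
      rw [show f ∘ g = id from funext h]; exact Function.bijective_id)
  have hM := linear_squareObj (c := c) hF
  exact isIso_app_of_bijective_squareHom (m.reducedQuadratic_tensor _) hF
    (key (m.bijective_unitHom_e _ hM) (m.squareHom_counit_unitHom_e hF))
    (key (m.bijective_unitHom_ee _ hM) (m.squareHom_counit_unitHom_ee hF)) hX

end CogroupModel

end CrossTrans

/-! ### The equivalence for a category with a cogroup model -/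

section Equivalence

variable {C : Type v} [Category.{w} C] [HasZeroMorphisms C] [HasBinaryCoproducts C]
  [HasZeroObject C] {E : C} {c : Comult E}

namespace SquareGroup

theorem isIso_of_bijective {M N : SquareGroup.{u}} (f : M ⟶ N) (h : Function.Bijective f.e)
    (h' : Function.Bijective f.ee) : IsIso f := by
  let e := AddEquiv.ofBijective f.e h
  let ee := AddEquiv.ofBijective f.ee h'
  have he (x : M.e) : e.symm (f.e x) = x := e.symm_apply_apply x
  have hee (x : M.ee) : ee.symm (f.ee x) = x := ee.symm_apply_apply x
  refine ⟨⟨e.symm.toAddMonoidHom, ee.symm.toAddMonoidHom, fun a => ?_, fun a => ?_⟩, ?_, ?_⟩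
  · obtain ⟨a, rfl⟩ := h.2 a
    change ee.symm (N.H (f.e a)) = M.H (e.symm (f.e a))
    rw [← f.comm_H, hee, he]
  · obtain ⟨a, rfl⟩ := h'.2 a
    change e.symm (N.P (f.ee a)) = M.P (ee.symm (f.ee a))
    rw [← f.comm_P, hee, he]
  · exact Hom.ext (AddMonoidHom.ext he) (AddMonoidHom.ext hee)
  · exact Hom.ext (AddMonoidHom.ext e.apply_symm_apply) (AddMonoidHom.ext ee.apply_symm_apply)

end SquareGroup

namespace CogroupModel

open SquareGroup

variable (m : CogroupModel.{u} c)

/-- The functor from square groups to functors given by the tensor product. -/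
noncomputable def tensorLift {Q : ObjectProperty (C ⥤ AddCommGrpCat.{u})}
    (hQ : ∀ M, linear M → Q (m.tensor M)) :
    linear.{u}.FullSubcategory ⥤ Q.FullSubcategory where
  obj M := ⟨m.tensor M.obj, hQ M.obj M.property⟩
  map f := ObjectProperty.homMk (Functor.whiskerLeft m.U (tensorTrans f.hom))
  map_id M := by
    refine ObjectProperty.hom_ext _ ?_
    change Functor.whiskerLeft m.U (tensorTrans (𝟙 M.obj)) = 𝟙 (m.tensor M.obj)
    rw [tensorTrans_id]
    rfl
  map_comp f g := by
    refine ObjectProperty.hom_ext _ ?_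
    change Functor.whiskerLeft m.U (tensorTrans (f.hom ≫ g.hom)) = Functor.whiskerLeft m.U _ ≫
      Functor.whiskerLeft m.U _
    rw [tensorTrans_comp]
    rfl

theorem counit_naturality {F G : C ⥤ AddCommGrpCat.{u}} (hF : reducedQuadratic C F)
    (hG : reducedQuadratic C G) (η : F ⟶ G) :
    Functor.whiskerLeft m.U (tensorTrans (squareHom hF hG c η)) ≫ m.counit hG =
      m.counit hF ≫ η := by
  ext X : 2
  refine AddCommGrpCat.hom_ext (Tensor.hom_ext (fun x a => ?_) (fun x y b => ?_))
  · change (m.counit hG).app X (Tensor.mapHom _ (squareHom hF hG c η) (Tensor.univ.lin x a)) =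
      η.app X ((m.counit hF).app X (Tensor.univ.lin x a))
    rw [Tensor.mapHom_lin]
    refine (m.counit_app_lin hG X x _).trans (Eq.trans ?_
      (congrArg (η.app X) (m.counit_app_lin hF X x a)).symm)
    exact (NatTrans.naturality_apply η (m.pt x) a).symm
  · change (m.counit hG).app X (Tensor.mapHom _ (squareHom hF hG c η) (Tensor.univ.quad x y b)) =
      η.app X ((m.counit hF).app X (Tensor.univ.quad x y b))
    rw [Tensor.mapHom_quad]
    refine (m.counit_app_quad hG X x y _).trans (Eq.trans ?_
      (congrArg (η.app X) (m.counit_app_quad hF X x y b)).symm)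
    exact (NatTrans.naturality_apply η (coprod.desc (m.pt x) (m.pt y)) b.1).symm

/-- A full subcategory of reduced quadratic functors which contains the tensor products and on
which the counit is invertible is equivalent to the category of square groups with linear `H`. -/
theorem isEquivalence {Q : ObjectProperty (C ⥤ AddCommGrpCat.{u})} (hle : Q ≤ reducedQuadratic C)
    (hQ : ∀ M, linear M → Q (m.tensor M))
    (hc : ∀ (F : C ⥤ AddCommGrpCat.{u}) (hF : Q F) (X : C), IsIso ((m.counit (hle F hF)).app X)) :
    (ObjectProperty.ιOfLE hle ⋙ squareFunctor c).IsEquivalence := by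
  let S := ObjectProperty.ιOfLE hle ⋙ squareFunctor c
  let T := m.tensorLift hQ
  have hunit (M : SquareGroup.{u}) (hM : linear M) : IsIso (m.unitHom M) :=
    isIso_of_bijective _ (m.bijective_unitHom_e M hM) (m.bijective_unitHom_ee M hM)
  have hcounit (F : Q.FullSubcategory) : IsIso (m.counit (hle _ F.property)) :=
    have := hc F.obj F.property
    NatIso.isIso_of_isIso_app _
  let η : 𝟭 _ ≅ T ⋙ S := NatIso.ofComponents
    (fun M => linear.isoMk (@asIso _ _ _ _ (m.unitHom M.obj) (hunit M.obj M.property)))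
    (fun {M N} f => by
      ext : 1
      refine Hom.ext (AddMonoidHom.ext fun a => ?_)
        (AddMonoidHom.ext fun b => Subtype.ext ?_)
      · exact (Tensor.mapHom_lin f.hom m.gen a).symm
      · exact (Tensor.mapHom_quad f.hom m.gen₁ m.gen₂ b).symm)
  let ε : S ⋙ T ≅ 𝟭 _ := NatIso.ofComponents
    (fun F => Q.isoMk (@asIso _ _ _ _ (m.counit (hle _ F.property)) (hcounit F)))
    (fun {F G} f => ObjectProperty.hom_ext _
      (m.counit_naturality (hle _ F.property) (hle _ G.property) f.hom))
  -- The unit and counit above belong to `T` as left adjoint of `S`; seen from `S` they exchange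
  -- roles, hence the inverses.
  exact Functor.IsEquivalence.mk' T ε.symm η.symm

end CogroupModel

end Equivalence

/-! ### Free groups of finite rank as a model -/

namespace FreeGrp

/-- The underlying group of a free group of finite rank. -/
def toGrp : FreeGrp ⥤ GrpCat.{u} where
  obj X := GrpCat.of (ULift.{u} (FreeGroup (Fin X.rank)))
  map f := GrpCat.ofHom (MulEquiv.ulift.symm.toMonoidHom.comp
    (f.hom.comp MulEquiv.ulift.toMonoidHom))

/-- An element of the free group, as an element of the underlying group. -/
def elt {X : FreeGrp} (x : FreeGroup (Fin X.rank)) : toGrp.{u}.obj X := ⟨x⟩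

theorem elt_injective {X : FreeGrp} : Function.Injective (elt.{u} (X := X)) :=
  ULift.up_injective

theorem elt_mem {X : FreeGrp} {S : Subgroup (toGrp.{u}.obj X)}
    (h : ∀ i, elt (FreeGroup.of i) ∈ S) (x : toGrp.{u}.obj X) : x ∈ S := by
  have : Subgroup.closure (Set.range (FreeGroup.of (α := Fin X.rank))) ≤
      S.comap MulEquiv.ulift.symm.toMonoidHom := by
    rw [Subgroup.closure_le]
    rintro _ ⟨i, rfl⟩
    exact h i
  rw [FreeGroup.closure_range_of] at this
  exact this (Subgroup.mem_top x.down)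

/-- The sum is the free group on the disjoint union of the generators. -/
noncomputable def sumIso (X Y : FreeGrp) : X ⨿ Y ≅ (⟨X.rank + Y.rank⟩ : FreeGrp) :=
  (coprodIsCoprod X Y).coconePointUniqueUpToIso (sumCofanIsColimit X Y)

theorem inl_sumIso (X Y : FreeGrp) : coprod.inl ≫ (sumIso X Y).hom = (sumCofan X Y).inl :=
  (coprodIsCoprod X Y).comp_coconePointUniqueUpToIso_hom (sumCofanIsColimit X Y) ⟨.left⟩

theorem inr_sumIso (X Y : FreeGrp) : coprod.inr ≫ (sumIso X Y).hom = (sumCofan X Y).inr :=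
  (coprodIsCoprod X Y).comp_coconePointUniqueUpToIso_hom (sumCofanIsColimit X Y) ⟨.right⟩

/-- The chosen coproduct is abstract, so the question is moved along `sumIso` to the free group on
`m + n` letters, each of which comes from one summand. -/
theorem closure_range_coprod (X Y : FreeGrp) :
    Subgroup.closure (Set.range (toGrp.{u}.map (coprod.inl : X ⟶ X ⨿ Y)) ∪
      Set.range (toGrp.{u}.map (coprod.inr : Y ⟶ X ⨿ Y))) = ⊤ := by
  set S := Subgroup.closure (Set.range (toGrp.{u}.map (coprod.inl : X ⟶ X ⨿ Y)) ∪
      Set.range (toGrp.{u}.map (coprod.inr : Y ⟶ X ⨿ Y))) with hS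
  refine (Subgroup.eq_top_iff' S).2 fun z => ?_
  have key (w : toGrp.{u}.obj ⟨X.rank + Y.rank⟩) :
      w ∈ S.comap (toGrp.{u}.map (sumIso X Y).inv).hom := by
    refine elt_mem (fun i => ?_) w
    refine Subgroup.mem_comap.2 (Subgroup.subset_closure ?_)
    dsimp only at i
    induction i using Fin.addCases with
    | left i =>
      refine Or.inl ⟨elt (FreeGroup.of i), ?_⟩
      rw [← Category.comp_id (coprod.inl : X ⟶ X ⨿ Y), ← (sumIso X Y).hom_inv_id,
        ← Category.assoc, inl_sumIso]
      exact congrArg (fun y => elt ((sumIso X Y).inv.hom y)) (FreeGroup.map.of)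
    | right i =>
      refine Or.inr ⟨elt (FreeGroup.of i), ?_⟩
      rw [← Category.comp_id (coprod.inr : Y ⟶ X ⨿ Y), ← (sumIso X Y).hom_inv_id,
        ← Category.assoc, inr_sumIso]
      exact congrArg (fun y => elt ((sumIso X Y).inv.hom y)) (FreeGroup.map.of)
  have h := Subgroup.mem_comap.1 (key (toGrp.{u}.map (sumIso X Y).hom z))
  change toGrp.{u}.map (sumIso X Y).inv (toGrp.{u}.map (sumIso X Y).hom z) ∈ S at h
  rwa [← GrpCat.comp_apply, ← Functor.map_comp, Iso.hom_inv_id, CategoryTheory.Functor.map_id] at h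

/-- The free groups of finite rank with the cogroup `ℤ`. -/
noncomputable def model : CogroupModel.{u} intComult where
  U := toGrp
  gen := elt (FreeGroup.of 0)
  pt x := ⟨FreeGroup.lift fun _ => x.down⟩
  map_pt x := congrArg elt (FreeGroup.lift_apply_of ..)
  pt_ext h := hom_ext fun i => by
    rw [Subsingleton.elim i 0]
    exact elt_injective h
  map_μ := congrArg elt (FreeGroup.lift_apply_of ..)
  map_zero _ := rfl
  closure_gen := (Subgroup.eq_top_iff' _).2 (elt_mem fun i => by
    rw [Subsingleton.elim i 0]
    exact Subgroup.subset_closure rfl)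
  closure_coprod := closure_range_coprod
  lift₁ K _ k := ⟨(FreeGroup.lift fun _ => k).comp MulEquiv.ulift.toMonoidHom,
    (FreeGroup.lift_apply_of : FreeGroup.lift (fun _ : Fin 1 => k) (FreeGroup.of 0) = k)⟩
  lift₂ K _ k l := by
    let φ : toGrp.{u}.obj ⟨1 + 1⟩ →* K :=
      (FreeGroup.lift (Fin.addCases (fun _ => k) (fun _ => l))).comp MulEquiv.ulift.toMonoidHom
    have hφ (i : Fin (1 + 1)) : φ (elt (FreeGroup.of i)) =
        Fin.addCases (fun _ => k) (fun _ => l) i := FreeGroup.lift_apply_of ..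
    refine ⟨φ.comp (toGrp.{u}.map (sumIso int int).hom).hom, ?_, ?_⟩
    · change φ (toGrp.{u}.map (sumIso int int).hom (toGrp.{u}.map coprod.inl _)) = k
      rw [← GrpCat.comp_apply, ← Functor.map_comp, inl_sumIso]
      exact (congrArg (fun y => φ (elt y)) FreeGroup.map.of).trans
        ((hφ _).trans (Fin.addCases_left _))
    · change φ (toGrp.{u}.map (sumIso int int).hom (toGrp.{u}.map coprod.inr _)) = l
      rw [← GrpCat.comp_apply, ← Functor.map_comp, inr_sumIso]
      exact (congrArg (fun y => φ (elt y)) FreeGroup.map.of).trans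
        ((hφ _).trans (Fin.addCases_right _))

theorem finitelyFree (X : FreeGrp) : FinitelyFree int X := by
  obtain ⟨n⟩ := X
  induction n with
  | zero => exact .zero ((IsZero.iff_id_eq_zero _).2 (hom_ext fun i => i.elim0))
  | succ n ih => exact .iso (sumIso ⟨n⟩ int) (.coprod ih)

end FreeGrp

/-! ### All groups as a model -/

namespace GrpCat

/-- Both injections factor through the subgroup they generate, so the coproduct maps to that
subgroup; followed by the inclusion, this is the identity by the universal property. -/
theorem closure_range_coprod (X Y : GrpCat.{u}) :
    Subgroup.closure (Set.range (coprod.inl : X ⟶ X ⨿ Y) ∪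
      Set.range (coprod.inr : Y ⟶ X ⨿ Y)) = ⊤ := by
  set S := Subgroup.closure (Set.range (coprod.inl : X ⟶ X ⨿ Y) ∪
      Set.range (coprod.inr : Y ⟶ X ⨿ Y)) with hS
  let f : X ⟶ of S := ofHom ((coprod.inl : X ⟶ X ⨿ Y).hom.codRestrict S
    fun x => Subgroup.subset_closure (Or.inl ⟨x, rfl⟩))
  let g : Y ⟶ of S := ofHom ((coprod.inr : Y ⟶ X ⨿ Y).hom.codRestrict S
    fun x => Subgroup.subset_closure (Or.inr ⟨x, rfl⟩))
  have h : coprod.desc f g ≫ ofHom S.subtype = 𝟙 (X ⨿ Y) := by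
    apply coprod.hom_ext
    · rw [coprod.inl_desc_assoc, Category.comp_id]; rfl
    · rw [coprod.inr_desc_assoc, Category.comp_id]; rfl
  refine (Subgroup.eq_top_iff' S).2 fun z => ?_
  have hz : (coprod.desc f g ≫ ofHom S.subtype) z = z := by rw [h]; rfl
  exact hz ▸ (coprod.desc f g z).2

/-- The morphism from the free group given by a family of elements. -/
def freeDesc {α : Type u} {X : GrpCat.{u}} (x : α → X) : of (FreeGroup α) ⟶ X :=
  ofHom (FreeGroup.lift x)

theorem freeDesc_of {α : Type u} {X : GrpCat.{u}} (x : α → X) (a : α) :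
    freeDesc x (FreeGroup.of a) = x a := FreeGroup.lift_apply_of ..

theorem freeDesc_comp_of {α : Type u} {X Y : GrpCat.{u}} (x : α → X) (f : X ⟶ Y) (a : α) :
    (freeDesc x ≫ f) (FreeGroup.of a) = f (x a) := congrArg f (freeDesc_of x a)

theorem free_hom_ext {α : Type u} {X : GrpCat.{u}} {f g : of (FreeGroup α) ⟶ X}
    (h : ∀ a, f (FreeGroup.of a) = g (FreeGroup.of a)) : f = g :=
  GrpCat.hom_ext (FreeGroup.ext_hom _ _ h)

/-- The category of groups with the cogroup `ℤ`. -/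
noncomputable def model : CogroupModel.{u} intComult.{u} where
  U := 𝟭 _
  gen := FreeGroup.of PUnit.unit
  pt x := freeDesc fun _ => x
  map_pt x := freeDesc_of ..
  pt_ext h := free_hom_ext fun _ => h
  map_μ := freeDesc_of ..
  map_zero _ := rfl
  closure_gen := by
    rw [← FreeGroup.closure_range_of, Set.range_unique]
  closure_coprod := closure_range_coprod
  lift₁ K _ k := ⟨FreeGroup.lift fun _ => k, FreeGroup.lift_apply_of ..⟩
  lift₂ K _ k l := by
    let f : int ⟶ of K := freeDesc fun _ => k
    let g : int ⟶ of K := freeDesc fun _ => l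
    refine ⟨(coprod.desc f g).hom, ?_, ?_⟩
    · change (coprod.inl ≫ coprod.desc f g) (FreeGroup.of PUnit.unit) = k
      rw [coprod.inl_desc]
      exact freeDesc_of ..
    · change (coprod.inr ≫ coprod.desc f g) (FreeGroup.of PUnit.unit) = l
      rw [coprod.inr_desc]
      exact freeDesc_of ..

/-- The free group on `α` and one further generator, as a sum. -/
def optionCofan (α : Type u) : BinaryCofan (of (FreeGroup α)) int.{u} :=
  BinaryCofan.mk (P := of (FreeGroup (Option α))) (freeDesc fun a => FreeGroup.of (some a))
    (freeDesc fun _ => FreeGroup.of none)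

/-- The universal property of the free group on `α` and one further generator. -/
def optionCofanIsColimit (α : Type u) : IsColimit (optionCofan α) :=
  BinaryCofan.IsColimit.mk _
    (fun f g => freeDesc fun o => o.elim (g (FreeGroup.of PUnit.unit)) fun a => f (FreeGroup.of a))
    (fun f g => free_hom_ext fun a => by
      exact Eq.trans (freeDesc_comp_of (X := of (FreeGroup (Option α))) _ _ a) (freeDesc_of ..))
    (fun f g => free_hom_ext fun a => by
      exact Eq.trans (freeDesc_comp_of (X := of (FreeGroup (Option α))) _ _ a) (freeDesc_of ..))
    (fun f g m hf hg => free_hom_ext fun o => by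
      refine Eq.trans ?_ (freeDesc_of _ o).symm
      subst hf hg
      cases o with
      | none => exact (congrArg m (freeDesc_of (X := of (FreeGroup (Option α))) ..)).symm
      | some a => exact (congrArg m (freeDesc_of (X := of (FreeGroup (Option α))) ..)).symm)

/-- Induction on the finite set: one more letter means one more summand `ℤ`. -/
theorem finitelyFree (α : Type u) [Finite α] : FinitelyFree int.{u} (of (FreeGroup α)) := by
  induction α using Finite.induction_empty_option with
  | of_equiv e h => exact .iso (FreeGroup.freeGroupCongr e).toGrpIso h
  | h_empty => exact .zero ((IsZero.iff_id_eq_zero _).2 (free_hom_ext fun a => a.elim))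
  | h_option h =>
    exact .iso ((coprodIsCoprod _ _).coconePointUniqueUpToIso (optionCofanIsColimit _)) (.coprod h)

end GrpCat

/-! ### Colimits preserved by the tensor product -/

section Preserves

namespace SquareGroup

variable {J : Type v} [Category.{w} J] {K : J ⥤ GrpCat.{u}}

/-- The tensor product preserves a cocone of groups if triples of elements of the tip come from
one group of the diagram and compatible functions of two variables descend to the tip. -/
theorem nonempty_isColimit_tensor (M : SquareGroup.{u}) (c : Cocone K)
    (hs : ∀ x y z : c.pt, ∃ (j : J) (x' y' z' : K.obj j),
      c.ι.app j x' = x ∧ c.ι.app j y' = y ∧ c.ι.app j z' = z)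
    (hd : ∀ (A : Type u) (φ : ∀ j, K.obj j → K.obj j → A),
      (∀ (j j' : J) (f : j ⟶ j') (x y : K.obj j), φ j' (K.map f x) (K.map f y) = φ j x y) →
      ∀ (j j' : J) (x y : K.obj j) (x' y' : K.obj j'), c.ι.app j x = c.ι.app j' x' →
        c.ι.app j y = c.ι.app j' y' → φ j x y = φ j' x' y') :
    Nonempty (IsColimit (M.tensorFunctor.mapCocone c)) := by
  have hs₂ (x y : c.pt) : ∃ (j : J) (x' y' : K.obj j), c.ι.app j x' = x ∧ c.ι.app j y' = y := by
    obtain ⟨j, x', y', -, hx, hy, -⟩ := hs x y y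
    exact ⟨j, x', y', hx, hy⟩
  -- Chosen representatives for every pair of elements; `qlin` and `qquad` show that the choice does
  -- not affect the values.
  choose j p₁ p₂ hp₁ hp₂ using hs₂
  let q (s : Cocone (K ⋙ M.tensorFunctor)) (j : J) : M.QuadraticMap (K.obj j) s.pt :=
    { lin := fun x a => s.ι.app j (Tensor.univ.lin x a : M.Tensor (K.obj j))
      quad := fun x y b => s.ι.app j (Tensor.univ.quad x y b : M.Tensor (K.obj j))
      lin_add := fun x a a' => (congrArg _ (Tensor.univ.lin_add x a a')).trans
        (map_add (s.ι.app j).hom _ _)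
      quad_add := fun x y b b' => (congrArg _ (Tensor.univ.quad_add x y b b')).trans
        (map_add (s.ι.app j).hom _ _)
      lin_mul := fun x y a => (congrArg _ (Tensor.univ.lin_mul x y a)).trans
        ((map_add (s.ι.app j).hom _ _).trans (congrArg (· + _) (map_add (s.ι.app j).hom _ _)))
      quad_mul_left := fun x x' y b => (congrArg _ (Tensor.univ.quad_mul_left x x' y b)).trans
        (map_add (s.ι.app j).hom _ _)
      quad_mul_right := fun x y y' b => (congrArg _ (Tensor.univ.quad_mul_right x y y' b)).trans
        (map_add (s.ι.app j).hom _ _)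
      quad_self := fun x b => congrArg _ (Tensor.univ.quad_self x b) }
  have nat (s : Cocone (K ⋙ M.tensorFunctor)) {j j' : J} (f : j ⟶ j') (t : M.Tensor (K.obj j)) :
      s.ι.app j' (Tensor.map M (K.map f).hom t) = s.ι.app j t :=
    ConcreteCategory.congr_hom (s.w f) t
  -- The function of two variables here ignores its second argument.
  have qlin (s : Cocone (K ⋙ M.tensorFunctor)) {j j' : J} (x : K.obj j) (x' : K.obj j')
      (hx : c.ι.app j x = c.ι.app j' x') (a : M.e) : (q s j).lin x a = (q s j').lin x' a :=
    hd s.pt (fun j x _ => (q s j).lin x a) (fun j j' f x _ =>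
      (congrArg (s.ι.app j') (Tensor.map_lin (K.map f).hom x a)).symm.trans (nat s f _))
      j j' x x x' x' hx hx
  have qquad (s : Cocone (K ⋙ M.tensorFunctor)) {j j' : J} (x y : K.obj j) (x' y' : K.obj j')
      (hx : c.ι.app j x = c.ι.app j' x') (hy : c.ι.app j y = c.ι.app j' y') (b : M.ee) :
      (q s j).quad x y b = (q s j').quad x' y' b :=
    hd s.pt (fun j x y => (q s j).quad x y b) (fun j j' f x y =>
      (congrArg (s.ι.app j') (Tensor.map_quad (K.map f).hom x y b)).symm.trans (nat s f _))
      j j' x y x' y' hx hy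
  have ι_mul (j : J) (x y : K.obj j) : c.ι.app j (x * y) = c.ι.app j x * c.ι.app j y :=
    map_mul (c.ι.app j).hom x y
  -- Each relation is verified at one object of the diagram carrying all the elements that occur.
  -- Bilinearity involves three elements, which is why `hs` speaks of triples.
  let Q (s : Cocone (K ⋙ M.tensorFunctor)) : M.QuadraticMap c.pt s.pt :=
    { lin := fun x a => (q s (j x x)).lin (p₁ x x) a
      quad := fun x y b => (q s (j x y)).quad (p₁ x y) (p₂ x y) b
      lin_add := fun x => (q s _).lin_add _
      quad_add := fun x y => (q s _).quad_add _ _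
      lin_mul := fun x y a => by
        obtain ⟨i, x', y', -, rfl, rfl, -⟩ := hs x y y
        rw [qlin s _ (x' * y') ((hp₁ _ _).trans (ι_mul i x' y').symm), qlin s _ x' (hp₁ _ _),
          qlin s _ y' (hp₁ _ _), qquad s _ _ x' y' (hp₁ _ _) (hp₂ _ _), (q s i).lin_mul]
      quad_mul_left := fun x y z b => by
        obtain ⟨i, x', y', z', rfl, rfl, rfl⟩ := hs x y z
        rw [qquad s _ _ (x' * y') z' ((hp₁ _ _).trans (ι_mul i x' y').symm) (hp₂ _ _),
          qquad s _ _ x' z' (hp₁ _ _) (hp₂ _ _), qquad s _ _ y' z' (hp₁ _ _) (hp₂ _ _),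
          (q s i).quad_mul_left]
      quad_mul_right := fun x y z b => by
        obtain ⟨i, x', y', z', rfl, rfl, rfl⟩ := hs x y z
        rw [qquad s _ _ x' (y' * z') (hp₁ _ _) ((hp₂ _ _).trans (ι_mul i y' z').symm),
          qquad s _ _ x' y' (hp₁ _ _) (hp₂ _ _), qquad s _ _ x' z' (hp₁ _ _) (hp₂ _ _),
          (q s i).quad_mul_right]
      quad_self := fun x b => by
        rw [← (q s _).quad_self]
        exact qquad s _ _ _ _ rfl ((hp₂ _ _).trans (hp₁ _ _).symm) b }
  refine ⟨{
    desc := fun s => AddCommGrpCat.ofHom (Q s).lift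
    fac := fun s i => AddCommGrpCat.hom_ext (Tensor.hom_ext (fun x a => ?_) (fun x y b => ?_))
    uniq := fun s f hf => AddCommGrpCat.hom_ext
      (Tensor.hom_ext (fun x a => ?_) (fun x y b => ?_)) }⟩
  · exact ((congrArg (Q s).lift (Tensor.map_lin (c.ι.app i).hom x a)).trans
      ((Q s).lift_lin _ a)).trans (qlin s _ x (hp₁ _ _) a)
  · exact ((congrArg (Q s).lift (Tensor.map_quad (c.ι.app i).hom x y b)).trans
      ((Q s).lift_quad _ _ b)).trans (qquad s _ _ x y (hp₁ _ _) (hp₂ _ _) b)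
  · refine Eq.trans ?_ ((Q s).lift_lin x a).symm
    refine Eq.trans ?_ (ConcreteCategory.congr_hom (hf (j x x))
      (Tensor.univ.lin (p₁ x x) a : M.Tensor (K.obj (j x x))))
    refine congrArg f (Eq.symm ((Tensor.map_lin (c.ι.app (j x x)).hom _ a).trans ?_))
    exact congrArg (Tensor.univ.lin · a) (hp₁ x x)
  · refine Eq.trans ?_ ((Q s).lift_quad x y b).symm
    refine Eq.trans ?_ (ConcreteCategory.congr_hom (hf (j x y))
      (Tensor.univ.quad (p₁ x y) (p₂ x y) b : M.Tensor (K.obj (j x y))))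
    refine congrArg f (Eq.symm ((Tensor.map_quad (c.ι.app (j x y)).hom _ _ b).trans ?_))
    exact congrArg₂ (Tensor.univ.quad · · b) (hp₁ x y) (hp₂ x y)

theorem preservesFilteredColimits_tensorFunctor (M : SquareGroup.{u}) :
    PreservesFilteredColimitsOfSize.{u, u} M.tensorFunctor := by
  refine ⟨fun J _ _ => ⟨fun {K} => ⟨fun {c} hc => ?_⟩⟩⟩
  have w {i j : J} (f : i ⟶ j) (x : K.obj i) : c.ι.app j (K.map f x) = c.ι.app i x :=
    ConcreteCategory.congr_hom (c.w f) x
  refine M.nonempty_isColimit_tensor c (fun x y z => ?_) (fun A φ hφ i j x y x' y' hx hy => ?_)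
  · obtain ⟨i, x, rfl⟩ := Concrete.isColimit_exists_rep K hc x
    obtain ⟨j, y, rfl⟩ := Concrete.isColimit_exists_rep K hc y
    obtain ⟨k, z, rfl⟩ := Concrete.isColimit_exists_rep K hc z
    obtain ⟨l, f, g, h, -⟩ : ∃ (l : J) (_ : i ⟶ l) (_ : j ⟶ l) (_ : k ⟶ l), True :=
      ⟨_, IsFiltered.firstToMax₃ i j k, IsFiltered.secondToMax₃ i j k,
        IsFiltered.thirdToMax₃ i j k, trivial⟩
    exact ⟨l, K.map f x, K.map g y, K.map h z, w f x, w g y, w h z⟩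
  · obtain ⟨k, f, g, h⟩ := Concrete.isColimit_exists_of_rep_eq K hc x x' hx
    obtain ⟨l, f', g', h'⟩ := Concrete.isColimit_exists_of_rep_eq K hc (K.map f y) (K.map g y')
      ((w f y).trans (hy.trans (w g y').symm))
    -- The pair `x, x'` already agrees at `k`, but `y, y'` agree only after two possibly different
    -- morphisms `f', g' : k ⟶ l`. Coequalizing these gives one stage at which both pairs agree.
    let e := IsFiltered.coeqHom f' g'
    have he : f' ≫ e = g' ≫ e := IsFiltered.coeq_condition f' g'
    have hx' : K.map (f ≫ f' ≫ e) x = K.map (g ≫ g' ≫ e) x' := by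
      rw [← he]
      simp only [K.map_comp, GrpCat.comp_apply]
      rw [h]
    have hy' : K.map (f ≫ f' ≫ e) y = K.map (g ≫ g' ≫ e) y' := by
      rw [K.map_comp, K.map_comp, K.map_comp, K.map_comp, GrpCat.comp_apply, GrpCat.comp_apply,
        GrpCat.comp_apply, GrpCat.comp_apply, h']
    rw [← hφ _ _ (f ≫ f' ≫ e), ← hφ _ _ (g ≫ g' ≫ e), hx', hy']

end SquareGroup

namespace GrpCat

variable {X Y : GrpCat.{u}} {f g : X ⟶ Y}

/-- The congruence on `Y` whose classes are identified by the coequalizer of a reflexive pair. -/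
def reflexiveCon (h : IsReflexivePair f g) : Con Y where
  r a b := ∃ x, f x = a ∧ g x = b
  iseqv := by
    obtain ⟨s, hf, hg⟩ := h.common_section
    have hf (y : Y) : f (s y) = y := ConcreteCategory.congr_hom hf y
    have hg (y : Y) : g (s y) = y := ConcreteCategory.congr_hom hg y
    refine ⟨fun a => ⟨s a, hf a, hg a⟩, ?_, ?_⟩
    · rintro _ _ ⟨x, rfl, rfl⟩
      -- The Mal'cev operation `a b⁻¹ c` of a group makes a reflexive compatible relation symmetric
      -- and, below, transitive; `s` supplies the reflexive pairs.
      refine ⟨s (f x) * x⁻¹ * s (g x), ?_, ?_⟩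
      · rw [map_mul, map_mul, map_inv, hf, hf, mul_inv_cancel, one_mul]
      · rw [map_mul, map_mul, map_inv, hg, hg, mul_assoc, inv_mul_cancel, mul_one]
    · rintro _ b _ ⟨x, rfl, rfl⟩ ⟨y, hy, rfl⟩
      refine ⟨x * (s (g x))⁻¹ * y, ?_, ?_⟩
      · rw [map_mul, map_mul, map_inv, hf, hy, mul_assoc, inv_mul_cancel, mul_one]
      · rw [map_mul, map_mul, map_inv, hg, mul_inv_cancel, one_mul]
  mul' := by
    rintro _ _ _ _ ⟨x, rfl, rfl⟩ ⟨y, rfl, rfl⟩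
    exact ⟨x * y, map_mul _ _ _, map_mul _ _ _⟩

/-- The quotient by `reflexiveCon` coequalizes the pair, so its projection factors through the
coequalizer. Thus elements identified there are already related by a single element of `X`. -/
theorem exists_of_coequalizer_eq (h : IsReflexivePair f g) {c : Cofork f g} (hc : IsColimit c)
    {a b : Y} (hab : c.π a = c.π b) : ∃ x, f x = a ∧ g x = b := by
  let q : Y ⟶ of (reflexiveCon h).Quotient := ofHom (reflexiveCon h).mk'
  have hq : f ≫ q = g ≫ q := GrpCat.hom_ext (MonoidHom.ext fun x =>
    ((reflexiveCon h).eq).2 ⟨x, rfl, rfl⟩)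
  obtain ⟨d, hd⟩ := Cofork.IsColimit.desc' hc q hq
  have (y : Y) : q y = d (c.π y) := (ConcreteCategory.congr_hom hd y).symm
  exact ((reflexiveCon h).eq).1 (show q a = q b by rw [this, this, hab])

/-- Two identifications in the coequalizer come from two elements of the same group `X`, so a
compatible function of two variables can be moved in both arguments at once. -/
theorem preservesColimit_tensorFunctor (M : SquareGroup.{u}) (h : IsReflexivePair f g) :
    PreservesColimit (parallelPair f g) M.tensorFunctor := by
  refine ⟨fun {c} hc => ?_⟩
  have hsurj : Function.Surjective (Cofork.π c) :=
    have := epi_of_isColimit_cofork hc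
    surjective_of_epi (Cofork.π c)
  refine M.nonempty_isColimit_tensor c (fun x y z => ?_) (fun A φ hφ i j x y x' y' hx hy => ?_)
  · obtain ⟨x, rfl⟩ := hsurj x
    obtain ⟨y, rfl⟩ := hsurj y
    obtain ⟨z, rfl⟩ := hsurj z
    exact ⟨.one, x, y, z, rfl, rfl, rfl⟩
  · have key (x y x' y' : Y) (hx : Cofork.π c x = Cofork.π c x')
        (hy : Cofork.π c y = Cofork.π c y') : φ .one x y = φ .one x' y' := by
      obtain ⟨r, rfl, rfl⟩ := exists_of_coequalizer_eq h hc hx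
      obtain ⟨s, rfl, rfl⟩ := exists_of_coequalizer_eq h hc hy
      exact (hφ _ _ .left r s).trans (hφ _ _ .right r s).symm
    have toOne (i : WalkingParallelPair) (x y : (parallelPair f g).obj i) :
        ∃ x₁ y₁ : Y, φ i x y = φ .one x₁ y₁ ∧ c.ι.app i x = Cofork.π c x₁ ∧
          c.ι.app i y = Cofork.π c y₁ := by
      cases i with
      | zero =>
        exact ⟨f x, f y, (hφ _ _ .left x y).symm,
          (ConcreteCategory.congr_hom (c.w WalkingParallelPairHom.left) x).symm,
          (ConcreteCategory.congr_hom (c.w WalkingParallelPairHom.left) y).symm⟩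
      | one => exact ⟨x, y, rfl, rfl, rfl⟩
    obtain ⟨x₁, y₁, h₁, hx₁, hy₁⟩ := toOne i x y
    obtain ⟨x₂, y₂, h₂, hx₂, hy₂⟩ := toOne j x' y'
    rw [h₁, h₂]
    exact key _ _ _ _ (hx₁.symm.trans (hx.trans hx₂)) (hy₁.symm.trans (hy.trans hy₂))

theorem goodQuadratic_tensorFunctor (M : SquareGroup.{u}) : goodQuadratic M.tensorFunctor :=
  ⟨model.reducedQuadratic_tensor M, M.preservesFilteredColimits_tensorFunctor,
    fun _ _ _ _ h => preservesColimit_tensorFunctor M h⟩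

end GrpCat

/-- A natural transformation between functors preserving a colimit is invertible at the colimit
if it is invertible on the diagram. -/
theorem isIso_app_of_isColimit {J C D : Type*} [Category* J] [Category* C] [Category* D]
    {K : J ⥤ C} {c : Cocone K} (hc : IsColimit c) {F G : C ⥤ D} [PreservesColimit K F]
    [PreservesColimit K G] (η : F ⟶ G) (h : ∀ j, IsIso (η.app (K.obj j))) :
    IsIso (η.app c.pt) := by
  have : ∀ j, IsIso ((Functor.whiskerLeft K η).app j) := h
  let e : K ⋙ F ≅ K ⋙ G := @asIso _ _ _ _ (Functor.whiskerLeft K η) (NatIso.isIso_of_isIso_app _)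
  let i := (isColimitOfPreserves F hc).coconePointsIsoOfNatIso (isColimitOfPreserves G hc) e
  have hi : i.hom = η.app c.pt := (isColimitOfPreserves F hc).hom_ext fun j => by
    rw [IsColimit.comp_coconePointsIsoOfNatIso_hom]
    exact (η.naturality (c.ι.app j)).symm
  exact hi ▸ i.isIso_hom

/-! ### From free groups of finite rank to all groups -/

namespace GrpCat

/-- The diagram of the free groups on the finite subsets of `α`. -/
def finsetDiagram (α : Type u) : Finset α ⥤ GrpCat.{u} where
  obj s := of (FreeGroup s)
  map {s t} f := freeDesc fun a => FreeGroup.of ⟨a.1, leOfHom f a.2⟩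
  map_id s := free_hom_ext fun a => freeDesc_of ..
  map_comp {s t r} f g := free_hom_ext fun a => by
    refine (freeDesc_of ..).trans (Eq.symm ?_)
    exact Eq.trans (freeDesc_comp_of (X := of (FreeGroup t)) _ _ a) (freeDesc_of ..)

/-- The free group on `α` as a cocone on the free groups on finite subsets. -/
def finsetCocone (α : Type u) : Cocone (finsetDiagram α) where
  pt := of (FreeGroup α)
  ι :=
    { app := fun s => freeDesc fun a => FreeGroup.of a.1
      naturality := fun s t f => free_hom_ext fun a => by
        refine Eq.trans (freeDesc_comp_of (X := of (FreeGroup t)) _ _ a) ?_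
        exact (freeDesc_of ..).trans (freeDesc_of (X := of (FreeGroup α)) ..).symm }

theorem finsetCocone_ι_of {α : Type u} (s : Finset α) (a : s) :
    (finsetCocone α).ι.app s (FreeGroup.of a : FreeGroup s) = (FreeGroup.of a.1 : FreeGroup α) :=
  freeDesc_of (X := of (FreeGroup α)) ..

/-- A free group is the colimit of the free groups on finite subsets. -/
def finsetCoconeIsColimit (α : Type u) : IsColimit (finsetCocone α) where
  -- The value on a letter is read off from the singleton containing it.
  desc s := freeDesc fun a => s.ι.app {a} (FreeGroup.of ⟨a, Finset.mem_singleton_self a⟩ :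
    FreeGroup ({a} : Finset α))
  fac s t := free_hom_ext fun a => by
    have h : ({a.1} : Finset α) ⟶ t := homOfLE (Finset.singleton_subset_iff.2 a.2)
    refine Eq.trans (freeDesc_comp_of (X := of (FreeGroup α)) _ _ a) ((freeDesc_of ..).trans ?_)
    refine (ConcreteCategory.congr_hom (s.w h) _).symm.trans (congrArg (s.ι.app t) ?_)
    exact freeDesc_of ..
  uniq s f hf := free_hom_ext fun a => by
    refine Eq.trans ?_ (freeDesc_of ..).symm
    refine Eq.trans ?_ (ConcreteCategory.congr_hom (hf {a}) _)
    exact congrArg f (finsetCocone_ι_of {a} ⟨a, _⟩).symm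

/-- The pairs of elements of the free group on `X` with the same image in `X`. -/
abbrev FreeRel (X : GrpCat.{u}) : Type u :=
  { p : FreeGroup X × FreeGroup X // FreeGroup.lift id p.1 = FreeGroup.lift id p.2 }

/-- The first morphism of the free presentation. -/
def relFst (X : GrpCat.{u}) : of (FreeGroup X.FreeRel) ⟶ of (FreeGroup X) :=
  freeDesc fun p => p.1.1

/-- The second morphism of the free presentation. -/
def relSnd (X : GrpCat.{u}) : of (FreeGroup X.FreeRel) ⟶ of (FreeGroup X) :=
  freeDesc fun p => p.1.2

theorem isReflexivePair_rel (X : GrpCat.{u}) : IsReflexivePair (relFst X) (relSnd X) :=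
  .mk' (freeDesc fun x => FreeGroup.of ⟨(FreeGroup.of x, FreeGroup.of x), rfl⟩)
    (free_hom_ext fun a => Eq.trans (freeDesc_comp_of (X := of (FreeGroup X.FreeRel)) _ _ a)
      (freeDesc_of ..))
    (free_hom_ext fun a => Eq.trans (freeDesc_comp_of (X := of (FreeGroup X.FreeRel)) _ _ a)
      (freeDesc_of ..))

/-- A group as the tip of its free presentation. -/
def relCofork (X : GrpCat.{u}) : Cofork (relFst X) (relSnd X) :=
  Cofork.ofπ (freeDesc id) (free_hom_ext fun p =>
    (congrArg (freeDesc id) (freeDesc_of (X := of (FreeGroup X)) ..)).trans (p.2.trans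
      (congrArg (freeDesc id) (freeDesc_of (X := of (FreeGroup X)) ..)).symm))

/-- A group is the coequalizer of its free presentation. -/
def relCoforkIsColimit (X : GrpCat.{u}) : IsColimit (relCofork X) :=
  Cofork.IsColimit.mk' _ fun s => by
    have hs (a b : FreeGroup X) (h : FreeGroup.lift id a = FreeGroup.lift id b) :
        Cofork.π s a = Cofork.π s b := by
      have := ConcreteCategory.congr_hom s.condition
        (FreeGroup.of ⟨(a, b), h⟩ : FreeGroup X.FreeRel)
      exact (congrArg (Cofork.π s) (freeDesc_of (X := of (FreeGroup X)) ..)).symm.trans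
        (this.trans (congrArg (Cofork.π s) (freeDesc_of (X := of (FreeGroup X)) ..)))
    refine ⟨ofHom (MonoidHom.mk' (fun x => Cofork.π s (FreeGroup.of x)) fun x y => ?_), ?_, ?_⟩
    -- The letter `xy` and the word formed by the letters `x` and `y` have the same image in the
    -- group, so their images under the cofork agree.
    · refine (hs _ (FreeGroup.of x * FreeGroup.of y) ?_).trans (map_mul _ _ _)
      simp
    · exact free_hom_ext fun x => congrArg (fun x => Cofork.π s (FreeGroup.of x)) (freeDesc_of ..)
    · intro m hm
      refine GrpCat.hom_ext (MonoidHom.ext fun x => ?_)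
      refine Eq.trans ?_ (ConcreteCategory.congr_hom hm (FreeGroup.of x))
      exact congrArg m (freeDesc_of id x).symm

/-- A natural transformation between functors on groups preserving filtered colimits and reflexive
coequalizers is invertible if it is invertible on the free groups of finite rank. -/
theorem isIso_app_of_finite {F G : GrpCat.{u} ⥤ AddCommGrpCat.{u}} (hF : goodQuadratic F)
    (hG : goodQuadratic G) (η : F ⟶ G)
    (h : ∀ (α : Type u) [Finite α], IsIso (η.app (of (FreeGroup α)))) (X : GrpCat.{u}) :
    IsIso (η.app X) := by
  have := hF.2.1
  have := hG.2.1
  -- Filtered colimits over finite subsets give all free groups; the reflexive free presentation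
  -- then gives every group.
  have hfree (α : Type u) : IsIso (η.app (of (FreeGroup α))) := by
    have : IsFiltered (Finset α) := by classical infer_instance
    have := PreservesFilteredColimitsOfSize.preserves_filtered_colimits (F := F) (Finset α)
    have := PreservesFilteredColimitsOfSize.preserves_filtered_colimits (F := G) (Finset α)
    exact isIso_app_of_isColimit (finsetCoconeIsColimit α) η fun s => h s
  have := hF.2.2 _ _ (isReflexivePair_rel X)
  have := hG.2.2 _ _ (isReflexivePair_rel X)
  refine isIso_app_of_isColimit (relCoforkIsColimit X) η fun i => ?_
  cases i with
  | zero => exact hfree _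
  | one => exact hfree _

end GrpCat

end Preserves

theorem mainTheorem11 :
    (squareFunctor.{u} FreeGrp.intComult).IsEquivalence ∧
      GrpCat.goodSquareFunctor.{u}.IsEquivalence :=
  -- Composing with the inclusion of the full subcategory into itself does not change the functor,
  -- by definition.
  ⟨FreeGrp.model.isEquivalence le_rfl (fun M _ => FreeGrp.model.reducedQuadratic_tensor M)
      fun _ hF X => FreeGrp.model.isIso_counit_app hF X.finitelyFree,
    GrpCat.model.isEquivalence (fun _ h => h.1)
      (fun M _ => GrpCat.goodQuadratic_tensorFunctor M) fun _ hF X =>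
        GrpCat.isIso_app_of_finite (GrpCat.goodQuadratic_tensorFunctor _) hF
          (GrpCat.model.counit hF.1)
          (fun α _ => GrpCat.model.isIso_counit_app hF.1 (GrpCat.finitelyFree α)) X⟩
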